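/- Let $\mathbb R^+=[0,\infty)$, let $k:\mathbb R^+\times\mathbb R^d\times\mathbb R^d\to\mathbb R^d$ and $L:\mathbb R^+\times\mathbb R^d\times\mathbb R^d\to\mathbb R^+$ be continuous, let $U\subset\mathbb R^d$ be compact and let $\Omega\subset\mathbb R^d$ be compact, with interior $\Omega^\circ$ and boundary $\partial\Omega$. Assume that there are constants $\kappa$, $C$, $\alpha>0$, $\beta_1\ge\beta_2>0$ such that, for all $t,s\in\mathbb R^+$, $x,x'\in\mathbb R^d$ and $u\in U$: $|k(t,x,u)|\le\kappa$; $|k(t,x,u)-k(s,x',u)|\le C(|t-s|+|x-x'|)$; for every $v\in\mathbb R^d$ there is $u_0\in U$ with $k(t,x,u_0)\cdot v\le-\alpha|v|$; $\beta_2\le L(t,x,u)\le\beta_1$; $|L(t,x,u)-L(t,x',u)|\le C|x-x'|$; and the set $\{(v,r)\in\mathbb R^{d}\times\mathbb R:\exists u\in U,\ k(t,x,u)=v,\ L(t,x,u)\le r\}$ is convex. For a control, i.e. a measurable $u:\mathbb R^+\to U$, let $\gamma$ be the trajectory with $\dot\gamma=k(t,\gamma,u)$ a.e., $\gamma(0)=x$;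 let $\tau\in[0,\infty]$ be the first time at which $\gamma$ reaches $y$, and let $J^{x,y}(u)=\int_0^{\tau}L(t,\gamma(t),u(t))\,dt$. A control is optimal from $x$ to $y$ if it minimizes $J^{x,y}$, and $c(x,y)$ is the minimal value. Let $\mu^\pm$ be finite positive measures on $\Omega$, and let $\psi^\pm\in C(\partial\Omega)$ satisfy $\psi^-(y)-\psi^+(x)\le c(x,y)$ for $x,y\in\partial\Omega$. Let $\mathcal P_0(\mu^+,\mu^-)$ be the set of finite positive measures $\pi$ on $\Omega\times\Omega$ whose marginals satisfy $(\pi_x)_{|\Omega^\circ}=\mu^+$ and $(\pi_y)_{|\Omega^\circ}=\mu^-$, and let $\mathcal T_1$ be the infimum over $\pi\in\mathcal P_0(\mu^+,\mu^-)$ of $$K(\pi)=\int_{\Omega\times\Omega}c\,d\pi+\int_{\partial\Omega}\psi^+\,d\pi_x-\int_{\partial\Omega}\psi^-\,d\pi_y .$$ For finite positive measures $\chi^\pm$ on $\mathbb R^d$ let $\mathcal E(\chi^+,\chi^-)$ be the set of pairs $(\rho,\eta)$, where $\rho=(\rho_t)_{t\ge0}$ is a measurable family of finite positive measures on $\mathbb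 R^d\times U$ with $\int_0^T\rho_t(\mathbb R^d\times U)\,dt<\infty$ for all $T$, and $\eta$ is a finite positive measure on $\mathbb R^+\times\mathbb R^d$, such that $\rho_0(\cdot,U)=\chi^+$, $\eta(\mathbb R^+,\cdot)=\chi^-$ and $$\int_{\mathbb R^+}\!\int_{\mathbb R^d\times U}\big[\partial_t\xi(t,x)+k(t,x,u)\cdot\nabla\xi(t,x)\big]\,d\rho_t(x,u)\,dt=\int_{\mathbb R^+\times\mathbb R^d}\xi\,d\eta-\int_{\mathbb R^d}\xi(0,x)\,d\chi^+(x)$$ for all compactly supported $C^1$ functions $\xi$ on $\mathbb R^+\times\mathbb R^d$. Let $\mathcal E_0(\mu^+,\mu^-)$ be the union of the sets $\mathcal E(\mu^++\chi^+,\mu^-+\chi^-)$ over all finite positive measures $\chi^\pm$ on $\partial\Omega$, and let $\mathcal T_2$ be the infimum over $(\rho,\eta)\in\mathcal E_0(\mu^+,\mu^-)$ of $$E(\rho,\eta)=\int_{\mathbb R^+}\!\int_{\mathbb R^d\times U}L(t,x,u)\,d\rho_t(x,u)\,dt+\int_{\partial\Omega\times U}\psi^+(x)\,d\rho_0(x,u)-\int_{\mathbb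 R^+\times\partial\Omega}\psi^-(y)\,d\eta(t,y).$$ (Infima are taken in $[-\infty,+\infty]$.) Then: 1. There is a Borel selection $(x,y)\mapsto(\gamma^{x,y},u^{x,y},\tau^{x,y})$ of an optimal trajectory, an optimal control and its (finite) first arrival time from $x$ to $y$, for $(x,y)\in\Omega\times\Omega$; Borel means that $\gamma^{x,y}(t)$ and $u^{x,y}(t)$ are jointly Borel in $(x,y,t)$ and that $\tau^{x,y}$ is Borel in $(x,y)$. 2. Let $\pi\in\mathcal P_0(\mu^+,\mu^-)$ be an optimal plan for $\mathcal T_1$. For every such selection, let $\rho_t$ be the push-forward of $\pi_{|\{(x,y)\,:\,t\le\tau^{x,y}\}}$ under $(x,y)\mapsto(\gamma^{x,y}(t),u^{x,y}(t))$ and let $\eta$ be the push-forward of $\pi$ under $(x,y)\mapsto(\tau^{x,y},y)$. Then $(\rho,\eta)\in\mathcal E_0(\mu^+,\mu^-)$ and $E(\rho,\eta)=K(\pi)$. 3. Consequently $\mathcal T_2\le\mathcal T_1$. -/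

import Mathlib

open MeasureTheory Set
open scoped NNReal ENNReal

/-- The state space `ℝ^d` with its Euclidean norm. -/
abbrev StateSpace (d : ℕ) : Type := EuclideanSpace ℝ (Fin d)

/-- Lebesgue measure on the half-line `ℝ⁺ = [0, ∞)` of times. -/
noncomputable def timeMeasure : Measure ℝ≥0 :=
  (volume : Measure ℝ).comap (fun t : ℝ≥0 => (t : ℝ))

section Control

variable {d : ℕ}

/-- `γ` is the admissible trajectory started at time `0` from `x` with the control `u`:
`u : ℝ⁺ → U` is measurable and `γ` is the (Carathéodory) solution of
`γ'(t) = k(t, γ(t), u(t))` for a.e. `t ≥ 0`, `γ(0) = x`, in integrated form. -/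
structure IsAdmissibleTrajectory
    (k : ℝ≥0 → StateSpace d → StateSpace d → StateSpace d) (U : Set (StateSpace d))
    (x : StateSpace d) (u : ℝ≥0 → U) (γ : ℝ≥0 → StateSpace d) : Prop where
  measurable_control : Measurable u
  continuous : Continuous γ
  integral_eq : ∀ t : ℝ≥0, γ t = x + ∫ s in Iic t, k s (γ s) (u s) ∂timeMeasure

/-- The first time at which `γ` reaches `y`, equal to `∞` if `γ` never reaches `y`. -/
noncomputable def hittingTimeOf (γ : ℝ≥0 → StateSpace d) (y : StateSpace d) : ℝ≥0∞ :=
  ⨅ (s : ℝ≥0) (_ : γ s = y), (s : ℝ≥0∞)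

/-- The cost `∫_0^τ L(t, γ(t), u(t)) dt`, where `τ` is the first time at which `γ` reaches `y`. -/
noncomputable def runningCost
    (L : ℝ≥0 → StateSpace d → StateSpace d → ℝ≥0) {U : Set (StateSpace d)}
    (u : ℝ≥0 → U) (γ : ℝ≥0 → StateSpace d) (y : StateSpace d) : ℝ≥0∞ :=
  ∫⁻ s in {s : ℝ≥0 | (s : ℝ≥0∞) < hittingTimeOf γ y}, (L s (γ s) (u s) : ℝ≥0∞) ∂timeMeasure

/-- The transport cost `c(x, y)`: the least cost over all controls steering `x` to `y`. -/
noncomputable def transportCost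
    (k : ℝ≥0 → StateSpace d → StateSpace d → StateSpace d)
    (L : ℝ≥0 → StateSpace d → StateSpace d → ℝ≥0) (U : Set (StateSpace d))
    (x y : StateSpace d) : ℝ≥0∞ :=
  ⨅ (u : ℝ≥0 → U) (γ : ℝ≥0 → StateSpace d) (_ : IsAdmissibleTrajectory k U x u γ),
    runningCost L u γ y

/-- `u`, with its trajectory `γ`, is an optimal control from `x` to `y`. -/
structure IsOptimalControl
    (k : ℝ≥0 → StateSpace d → StateSpace d → StateSpace d)
    (L : ℝ≥0 → StateSpace d → StateSpace d → ℝ≥0) (U : Set (StateSpace d))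
    (x y : StateSpace d) (u : ℝ≥0 → U) (γ : ℝ≥0 → StateSpace d) : Prop where
  admissible : IsAdmissibleTrajectory k U x u γ
  minimal : ∀ (u' : ℝ≥0 → U) (γ' : ℝ≥0 → StateSpace d),
    IsAdmissibleTrajectory k U x u' γ' → runningCost L u γ y ≤ runningCost L u' γ' y

/-- `(x, y) ↦ (γ^{x,y}, u^{x,y}, τ^{x,y})` is a Borel selection, over `Ω × Ω`, of an optimal
trajectory, an optimal control and the corresponding end time. Values at `(x, y) ∉ Ω × Ω` play
no role. -/
structure IsBorelOptimalSelection
    (k : ℝ≥0 → StateSpace d → StateSpace d → StateSpace d)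
    (L : ℝ≥0 → StateSpace d → StateSpace d → ℝ≥0) (U Ω : Set (StateSpace d))
    (γ : StateSpace d × StateSpace d → ℝ≥0 → StateSpace d)
    (u : StateSpace d × StateSpace d → ℝ≥0 → U)
    (τ : StateSpace d × StateSpace d → ℝ≥0) : Prop where
  measurable_trajectory : Measurable (Function.uncurry γ)
  measurable_control : Measurable (Function.uncurry u)
  measurable_endTime : Measurable τ
  optimal : ∀ x ∈ Ω, ∀ y ∈ Ω, IsOptimalControl k L U x y (u (x, y)) (γ (x, y))
  endTime_eq : ∀ x ∈ Ω, ∀ y ∈ Ω, (τ (x, y) : ℝ≥0∞) = hittingTimeOf (γ (x, y)) y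

end Control

section Kantorovich

variable {d : ℕ}

/-- The set `𝒫₀(μ⁺, μ⁻)`: finite positive measures on `Ω × Ω` whose marginals, restricted to the
interior of `Ω`, are `μ⁺` and `μ⁻`. -/
def admissiblePlans (Ω : Set (StateSpace d)) (μp μm : Measure (StateSpace d)) :
    Set (Measure (StateSpace d × StateSpace d)) :=
  {π | IsFiniteMeasure π ∧ π (Ω ×ˢ Ω)ᶜ = 0 ∧
    π.fst.restrict (interior Ω) = μp ∧ π.snd.restrict (interior Ω) = μm}

/-- `∫ c dπ + ∫_{∂Ω} ψ⁺ dπ_x - ∫_{∂Ω} ψ⁻ dπ_y`. -/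
noncomputable def kantorovichCost
    (k : ℝ≥0 → StateSpace d → StateSpace d → StateSpace d)
    (L : ℝ≥0 → StateSpace d → StateSpace d → ℝ≥0) (U Ω : Set (StateSpace d))
    (ψp ψm : StateSpace d → ℝ) (π : Measure (StateSpace d × StateSpace d)) : EReal :=
  ((∫⁻ p, transportCost k L U p.1 p.2 ∂π : ℝ≥0∞) : EReal)
    + ((∫ x in frontier Ω, ψp x ∂π.fst : ℝ) : EReal)
    - ((∫ y in frontier Ω, ψm y ∂π.snd : ℝ) : EReal)

/-- The value `𝒯₁` of the Kantorovich problem with import/export tariffs. -/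
noncomputable def kantorovichValue
    (k : ℝ≥0 → StateSpace d → StateSpace d → StateSpace d)
    (L : ℝ≥0 → StateSpace d → StateSpace d → ℝ≥0) (U Ω : Set (StateSpace d))
    (ψp ψm : StateSpace d → ℝ) (μp μm : Measure (StateSpace d)) : EReal :=
  ⨅ π ∈ admissiblePlans Ω μp μm, kantorovichCost k L U Ω ψp ψm π

/-- `π` is an optimal plan for `𝒯₁`. -/
def IsOptimalPlan
    (k : ℝ≥0 → StateSpace d → StateSpace d → StateSpace d)
    (L : ℝ≥0 → StateSpace d → StateSpace d → ℝ≥0) (U Ω : Set (StateSpace d))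
    (ψp ψm : StateSpace d → ℝ) (μp μm : Measure (StateSpace d))
    (π : Measure (StateSpace d × StateSpace d)) : Prop :=
  π ∈ admissiblePlans Ω μp μm ∧
    kantorovichCost k L U Ω ψp ψm π = kantorovichValue k L U Ω ψp ψm μp μm

end Kantorovich

section Eulerian

variable {d : ℕ}

/-- `(ρ, η) ∈ ℰ(χ⁺, χ⁻)`: `ρ : ℝ⁺ → ℳ⁺(ℝ^d × U)` is a density process and
`η ∈ ℳ⁺(ℝ⁺ × ℝ^d)` a stopping distribution between `χ⁺` and `χ⁻`. The first four fields say that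
all the objects and integrals involved make sense; then `ρ₀(·, U) = χ⁺`, `η(ℝ⁺, ·) = χ⁻`, and
`η + ∂ₜ ∫_U dρ + ∇ · ∫_U k dρ = 0` weakly with initial datum `χ⁺`. Test functions are the
restrictions to `ℝ⁺ × ℝ^d` of compactly supported `C¹` functions `ξ`, and
`fderiv ℝ ξ (t, x) (1, v)` is `∂ₜξ(t, x) + v · ∇ξ(t, x)`. -/
structure IsEulerianPair
    (k : ℝ≥0 → StateSpace d → StateSpace d → StateSpace d) (U : Set (StateSpace d))
    (χp χm : Measure (StateSpace d))
    (ρ : ℝ≥0 → Measure (StateSpace d × U)) (η : Measure (ℝ≥0 × StateSpace d)) : Prop where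
  measurable_density : Measurable ρ
  finite_density : ∀ t, IsFiniteMeasure (ρ t)
  locallyFinite_density : ∀ T : ℝ≥0, ∫⁻ t in Iic T, ρ t univ ∂timeMeasure < ∞
  finite_stopping : IsFiniteMeasure η
  initial_eq : (ρ 0).fst = χp
  stopping_eq : η.snd = χm
  continuity_eq : ∀ ξ : ℝ × StateSpace d → ℝ, ContDiff ℝ 1 ξ → HasCompactSupport ξ →
    ∫ t : ℝ≥0, (∫ p : StateSpace d × U,
        fderiv ℝ ξ ((t : ℝ), p.1) (1, k t p.1 p.2) ∂(ρ t)) ∂timeMeasure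
      = ∫ q : ℝ≥0 × StateSpace d, ξ ((q.1 : ℝ), q.2) ∂η - ∫ x, ξ (0, x) ∂χp

/-- The set `ℰ₀(μ⁺, μ⁻)`: Eulerian pairs in `ℰ(μ⁺ + χ⁺, μ⁻ + χ⁻)` for some finite positive
measures `χ⁺, χ⁻` on `∂Ω`. -/
def admissibleEulerianPairs
    (k : ℝ≥0 → StateSpace d → StateSpace d → StateSpace d) (U Ω : Set (StateSpace d))
    (μp μm : Measure (StateSpace d)) :
    Set ((ℝ≥0 → Measure (StateSpace d × U)) × Measure (ℝ≥0 × StateSpace d)) :=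
  {E | ∃ χp χm : Measure (StateSpace d), IsFiniteMeasure χp ∧ IsFiniteMeasure χm ∧
    χp (frontier Ω)ᶜ = 0 ∧ χm (frontier Ω)ᶜ = 0 ∧
    IsEulerianPair k U (μp + χp) (μm + χm) E.1 E.2}

/-- `∫∫ L dρ_t dt + ∫_{∂Ω × U} ψ⁺(x) dρ₀(x, u) - ∫_{ℝ⁺ × ∂Ω} ψ⁻(y) dη(t, y)`. -/
noncomputable def eulerianCost
    (L : ℝ≥0 → StateSpace d → StateSpace d → ℝ≥0) {U : Set (StateSpace d)}
    (Ω : Set (StateSpace d)) (ψp ψm : StateSpace d → ℝ)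
    (ρ : ℝ≥0 → Measure (StateSpace d × U)) (η : Measure (ℝ≥0 × StateSpace d)) : EReal :=
  ((∫⁻ t : ℝ≥0, (∫⁻ p, (L t p.1 p.2 : ℝ≥0∞) ∂(ρ t)) ∂timeMeasure : ℝ≥0∞) : EReal)
    + ((∫ p in frontier Ω ×ˢ univ, ψp p.1 ∂(ρ 0) : ℝ) : EReal)
    - ((∫ q in univ ×ˢ frontier Ω, ψm q.2 ∂η : ℝ) : EReal)

/-- The value `𝒯₂` of the Eulerian problem with import/export tariffs. -/
noncomputable def eulerianValue
    (k : ℝ≥0 → StateSpace d → StateSpace d → StateSpace d)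
    (L : ℝ≥0 → StateSpace d → StateSpace d → ℝ≥0) (U Ω : Set (StateSpace d))
    (ψp ψm : StateSpace d → ℝ) (μp μm : Measure (StateSpace d)) : EReal :=
  ⨅ E ∈ admissibleEulerianPairs k U Ω μp μm, eulerianCost L Ω ψp ψm E.1 E.2

/-- The density process carried by the plan `π` along a selection: `ρ_t` is the push-forward of
`π`, restricted to `{(x, y) : t ≤ τ^{x,y}}`, under `(x, y) ↦ (γ^{x,y}(t), u^{x,y}(t))`. -/
noncomputable def planDensity {U : Set (StateSpace d)}
    (γ : StateSpace d × StateSpace d → ℝ≥0 → StateSpace d)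
    (u : StateSpace d × StateSpace d → ℝ≥0 → U)
    (τ : StateSpace d × StateSpace d → ℝ≥0)
    (π : Measure (StateSpace d × StateSpace d)) : ℝ≥0 → Measure (StateSpace d × U) :=
  fun t => (π.restrict {p | t ≤ τ p}).map (fun p => (γ p t, u p t))

/-- The stopping distribution of the plan `π` along a selection: the push-forward of `π` under
`(x, y) ↦ (τ^{x,y}, y)`. -/
noncomputable def planStopping (τ : StateSpace d × StateSpace d → ℝ≥0)
    (π : Measure (StateSpace d × StateSpace d)) : Measure (ℝ≥0 × StateSpace d) :=
  π.map (fun p => (τ p, p.2))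

end Eulerian

/-! Optimal controls carry no useful topology, so the minimization is moved to curves `w = (γ, z)`,
the trajectory together with its accumulated cost. For a functional `f` that is nonnegative on the
cost direction, a driven curve satisfies `∫ H_f(r, γ(r)) dr ≤ f(w t - w s)`, where `H_f` is the
minimum over `U` of `f` applied to velocity and running cost. These inequalities contain no
derivative, so they pass to pointwise limits of equi-Lipschitz curves
(`isClosed_isRelaxedSolution`), and such curves form a compact metrizable space.

Nothing is lost by this relaxation. At a point of differentiability the inequalities place the
derivative in the convex closed epigraph of velocities and costs, by Hahn–Banach
(`IsRelaxedSolution.mem_velocityEpigraph`). A fixed Borel selector `σ` then returns a control with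
exactly that velocity and no greater cost (`exists_measurable_control`,
`IsRelaxedSolution.isAdmissibleTrajectory`).

Any two points are joined by a relaxed solution in bounded time: Euler polygons with a feedback
pointing at the target approach it at speed at least `α / 2`, and a limit of them arrives
(`exists_isRelaxedSolution_reaching`). Since the running cost is bounded below, late arrivals can be
discarded. What remains is to minimize a continuous function over the fibers of a closed graph in a
compact space, and measurable selection gives Borel minimizers (`exists_measurable_argmin`).

The Eulerian statement is Fubini combined with the fundamental theorem of calculus along each
selected trajectory. Every admissible plan thereby yields an Eulerian pair of the same cost, whence
the inequality between the values. -/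

/-! ### Measurable selection of closed-valued maps and of minimizers. -/

/-- One refinement step of the Kuratowski–Ryll-Nardzewski construction. -/
theorem exists_measurable_refinement {X K : Type*} [MeasurableSpace X] [MetricSpace K]
    [CompactSpace K] {r : ℝ} (hr : 0 < r) (σ : X → Set K) (hσ : ∀ x, IsClosed (σ x))
    (hne : ∀ x, (σ x).Nonempty)
    (hm : ∀ C, IsClosed C → MeasurableSet {x | (σ x ∩ C).Nonempty}) :
    ∃ σ' : X → Set K, (∀ x, IsClosed (σ' x)) ∧ (∀ x, (σ' x).Nonempty) ∧
      (∀ C, IsClosed C → MeasurableSet {x | (σ' x ∩ C).Nonempty}) ∧ (∀ x, σ' x ⊆ σ x) ∧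
      ∀ x, ∃ c, σ' x ⊆ Metric.closedBall c r := by
  rcases isEmpty_or_nonempty X with hX | ⟨⟨x₀⟩⟩
  · exact ⟨σ, hσ, hne, hm, fun x => Subset.rfl, fun x => hX.elim x⟩
  obtain ⟨k₀, -⟩ := hne x₀
  have : Nonempty K := ⟨k₀⟩
  classical
  let B : ℕ → Set K := fun j => Metric.closedBall (TopologicalSpace.denseSeq K j) r
  have hB : ∀ j, IsClosed (B j) := fun j => Metric.isClosed_closedBall
  have hex : ∀ x, ∃ j, (σ x ∩ B j).Nonempty := by
    intro x
    obtain ⟨k, hk⟩ := hne x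
    obtain ⟨j, hj⟩ :=
      (TopologicalSpace.denseRange_denseSeq K).exists_dist_lt k hr
    exact ⟨j, k, hk, Metric.mem_closedBall.2 hj.le⟩
  -- Taking the first ball that meets `σ x` makes the choice of index measurable: it equals `j` when
  -- `B j` is met and no earlier ball is.
  refine ⟨fun x => σ x ∩ B (Nat.find (hex x)), fun x => (hσ x).inter (hB _),
    fun x => Nat.find_spec (hex x), fun C hC => ?_, fun x => inter_subset_left,
    fun x => ⟨_, inter_subset_right⟩⟩
  have : {x | (σ x ∩ B (Nat.find (hex x)) ∩ C).Nonempty}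
      = ⋃ j, ({x | (σ x ∩ (B j ∩ C)).Nonempty} ∩ ⋂ i ∈ Finset.range j,
          {x | (σ x ∩ B i).Nonempty}ᶜ) := by
    ext x
    simp only [mem_ofPred_eq, mem_iUnion, mem_inter_iff, mem_iInter, Finset.mem_range,
      mem_compl_iff]
    constructor
    · intro h
      exact ⟨Nat.find (hex x), by rwa [← inter_assoc], fun i hi => Nat.find_min (hex x) hi⟩
    · rintro ⟨j, hj, hmin⟩
      have hj' : Nat.find (hex x) = j := by
        rw [Nat.find_eq_iff]
        exact ⟨hj.mono fun k hk => ⟨hk.1, hk.2.1⟩, fun i hi => hmin i hi⟩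
      rw [hj', inter_assoc]
      exact hj
  rw [this]
  refine MeasurableSet.iUnion fun j => (hm _ ((hB j).inter hC)).inter ?_
  exact Finset.measurableSet_biInter _ fun i _ => (hm _ (hB i)).compl

/-- The Kuratowski–Ryll-Nardzewski selection theorem in a compact metric space. -/
theorem exists_measurable_selection {X K : Type*} [MeasurableSpace X] [MetricSpace K]
    [CompactSpace K] [MeasurableSpace K] [BorelSpace K] (σ : X → Set K)
    (hσ : ∀ x, IsClosed (σ x)) (hne : ∀ x, (σ x).Nonempty)
    (hm : ∀ C, IsClosed C → MeasurableSet {x | (σ x ∩ C).Nonempty}) :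
    ∃ f : X → K, Measurable f ∧ ∀ x, f x ∈ σ x := by
  let P : (X → Set K) → Prop := fun σ => (∀ x, IsClosed (σ x)) ∧ (∀ x, (σ x).Nonempty) ∧
    ∀ C, IsClosed C → MeasurableSet {x | (σ x ∩ C).Nonempty}
  have step : ∀ (n : ℕ) (s : {σ // P σ}), ∃ s' : {σ // P σ}, (∀ x, s'.1 x ⊆ s.1 x) ∧
      ∀ x, ∃ c, s'.1 x ⊆ Metric.closedBall c (1 / ((n : ℝ) + 1)) := by
    rintro n ⟨s, h1, h2, h3⟩
    obtain ⟨s', h1', h2', h3', h4, h5⟩ :=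
      exists_measurable_refinement (r := 1 / ((n : ℝ) + 1)) (by positivity) s h1 h2 h3
    exact ⟨⟨s', h1', h2', h3'⟩, h4, h5⟩
  choose next hsub hball using step
  let S : ℕ → {σ // P σ} := fun n => Nat.rec ⟨σ, hσ, hne, hm⟩ next n
  have hS : ∀ n, S (n + 1) = next n (S n) := fun n => rfl
  have hI : ∀ x, (⋂ n, (S n).1 x).Nonempty := fun x =>
    IsCompact.nonempty_iInter_of_sequence_nonempty_isCompact_isClosed _
      (fun n => by rw [hS]; exact hsub n (S n) x) (fun n => (S n).2.2.1 x)
      ((S 0).2.1 x).isCompact (fun n => (S n).2.1 x)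
  choose f hf using hI
  have hf' : ∀ x n, f x ∈ (S n).1 x := fun x n => mem_iInter.1 (hf x) n
  refine ⟨f, measurable_of_isClosed fun C hC => ?_, fun x => hf' x 0⟩
  -- The nested sets shrink to the point `f x`, so points of `C` chosen in each of them converge to
  -- `f x`, which then lies in `C`.
  have : f ⁻¹' C = ⋂ n, {x | ((S n).1 x ∩ C).Nonempty} := by
    ext x
    simp only [mem_preimage, mem_iInter, mem_ofPred_eq]
    refine ⟨fun h n => ⟨f x, hf' x n, h⟩, fun h => ?_⟩
    choose y hy hyC using h
    have hlim : Filter.Tendsto (fun n => y (n + 1)) Filter.atTop (nhds (f x)) := by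
      rw [tendsto_iff_dist_tendsto_zero]
      have h0 : Filter.Tendsto (fun n : ℕ => 2 * (1 / ((n : ℝ) + 1))) Filter.atTop (nhds 0) := by
        simpa using (tendsto_one_div_add_atTop_nhds_zero_nat (𝕜 := ℝ)).const_mul 2
      refine squeeze_zero (fun n => dist_nonneg) (fun n => ?_) h0
      obtain ⟨c, hc⟩ := hball n (S n) x
      have h1 := Metric.mem_closedBall.1 (hc (hy (n + 1)))
      have h2 := Metric.mem_closedBall'.1 (hc (hf' x (n + 1)))
      linarith [dist_triangle (y (n + 1)) c (f x)]
    exact hC.mem_of_tendsto hlim (Filter.Eventually.of_forall fun n => hyC (n + 1))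
  rw [this]
  exact MeasurableSet.iInter fun n => (S n).2.2.2 C hC

/-- A Borel selection of minimizers: if `G` has closed graph and nonempty fibers in a compact
space and `φ` is continuous, minimizers of `φ` on the fibers of `G` can be chosen measurably. -/
theorem exists_measurable_argmin {X K : Type*} [TopologicalSpace X] [MeasurableSpace X]
    [BorelSpace X] [TopologicalSpace K] [TopologicalSpace.MetrizableSpace K]
    [CompactSpace K] [MeasurableSpace K] [BorelSpace K] {G : Set (X × K)} (hG : IsClosed G)
    (hne : ∀ x, ∃ w, (x, w) ∈ G) {φ : K → ℝ} (hφ : Continuous φ) :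
    ∃ f : X → K, Measurable f ∧ ∀ x, (x, f x) ∈ G ∧ ∀ w, (x, w) ∈ G → φ (f x) ≤ φ w := by
  let _ := TopologicalSpace.metrizableSpaceMetric K
  have hfib : ∀ x, IsClosed {w | (x, w) ∈ G} := fun x =>
    hG.preimage (Continuous.prodMk_right x)
  have hproj : ∀ (C : Set K) (q : ℝ), IsClosed C →
      MeasurableSet {x | ∃ w, (x, w) ∈ G ∧ w ∈ C ∧ φ w ≤ q} := by
    intro C q hC
    have hcl : IsClosed (G ∩ (Prod.snd ⁻¹' (C ∩ {w | φ w ≤ q}))) :=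
      hG.inter ((hC.inter (isClosed_le hφ continuous_const)).preimage continuous_snd)
    have := (isClosedMap_fst_of_compactSpace _ hcl).measurableSet
    convert this using 1
    ext x
    simp [and_assoc]
  have hmin : ∀ (C : Set K) (x : X), IsClosed C → (∃ w ∈ C, (x, w) ∈ G) →
      ∃ w ∈ C, (x, w) ∈ G ∧ ∀ w' ∈ C, (x, w') ∈ G → φ w ≤ φ w' := by
    rintro C x hC ⟨w, hw, hwG⟩
    obtain ⟨m, ⟨hmC, hmG⟩, hm⟩ := (hC.inter (hfib x)).isCompact.exists_isMinOn ⟨w, hw, hwG⟩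
      hφ.continuousOn
    exact ⟨m, hmC, hmG, fun w' h1 h2 => hm ⟨h1, h2⟩⟩
  refine (exists_measurable_selection
    (fun x => {w | (x, w) ∈ G ∧ ∀ w', (x, w') ∈ G → φ w ≤ φ w'}) (fun x => ?_) (fun x => ?_)
    (fun C hC => ?_))
  · have : {w | (x, w) ∈ G ∧ ∀ w', (x, w') ∈ G → φ w ≤ φ w'}
        = {w | (x, w) ∈ G} ∩ ⋂ w' ∈ {w' | (x, w') ∈ G}, {w | φ w ≤ φ w'} := by
      ext w; simp
    rw [this]
    exact (hfib x).inter (isClosed_biInter fun w' _ => isClosed_le hφ continuous_const)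
  · obtain ⟨w, hw⟩ := hne x
    obtain ⟨m, -, hmG, hm⟩ := hmin univ x isClosed_univ ⟨w, mem_univ _, hw⟩
    exact ⟨m, hmG, fun w' h => hm w' (mem_univ _) h⟩
  -- A minimizer lies in `C` exactly when the minimum over the fiber equals the minimum over its
  -- part in `C`. Rational levels express this through countably many projections of closed sets
  -- along a compact factor.
  · have : {x | ({w | (x, w) ∈ G ∧ ∀ w', (x, w') ∈ G → φ w ≤ φ w'} ∩ C).Nonempty}
        = ⋂ q : ℚ, ({x | ∃ w, (x, w) ∈ G ∧ w ∈ univ ∧ φ w ≤ q}ᶜ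
          ∪ {x | ∃ w, (x, w) ∈ G ∧ w ∈ C ∧ φ w ≤ q}) := by
      ext x
      simp only [mem_ofPred_eq, mem_iInter, mem_union, mem_compl_iff]
      constructor
      · rintro ⟨w, ⟨hwG, hw⟩, hwC⟩ q
        by_cases h : ∃ w, (x, w) ∈ G ∧ w ∈ univ ∧ φ w ≤ q
        · obtain ⟨w', h1, -, h2⟩ := h
          exact Or.inr ⟨w, hwG, hwC, (hw w' h1).trans h2⟩
        · exact Or.inl h
      · intro h
        obtain ⟨w₀, hw₀⟩ := hne x
        obtain ⟨m, -, hmG, hm⟩ := hmin univ x isClosed_univ ⟨w₀, mem_univ _, hw₀⟩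
        have key : ∀ q : ℚ, φ m < q → ∃ w, (x, w) ∈ G ∧ w ∈ C ∧ φ w ≤ q := fun q hq =>
          (h q).resolve_left (not_not.2 ⟨m, hmG, mem_univ _, hq.le⟩)
        obtain ⟨q₀, hq₀⟩ := exists_rat_gt (φ m)
        obtain ⟨w₁, h1, h2, -⟩ := key q₀ hq₀
        obtain ⟨n, hnC, hnG, hn⟩ := hmin C x hC ⟨w₁, h2, h1⟩
        have hle : φ n ≤ φ m := by
          by_contra hlt
          obtain ⟨q, hq1, hq2⟩ := exists_rat_btwn (not_le.1 hlt)
          obtain ⟨w, h1, h2, h3⟩ := key q hq1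
          linarith [hn w h2 h1]
        exact ⟨n, ⟨hnG, fun w' h => hle.trans (hm w' (mem_univ _) h)⟩, hnC⟩
    rw [this]
    exact MeasurableSet.iInter fun q =>
      (hproj univ q isClosed_univ).compl.union (hproj C q hC)

/-! ### Integration over the half-line, and the fundamental theorem of calculus for Lipschitz
curves. -/

theorem measurableEmbedding_nnreal_coe : MeasurableEmbedding (fun t : ℝ≥0 => (t : ℝ)) :=
  MeasurableEmbedding.subtype_coe measurableSet_Ici

theorem map_coe_timeMeasure :
    timeMeasure.map (fun t : ℝ≥0 => (t : ℝ)) = (volume : Measure ℝ).restrict (Ici 0) := by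
  rw [timeMeasure, measurableEmbedding_nnreal_coe.map_comap]
  congr 1
  exact Subtype.range_coe

instance : NullSingletonClass timeMeasure :=
  ⟨fun t => by
    rw [timeMeasure, measurableEmbedding_nnreal_coe.comap_apply, image_singleton,
      Real.volume_singleton]⟩

theorem map_coe_timeMeasure_restrict_Iic (t : ℝ≥0) :
    (timeMeasure.restrict (Iic t)).map (fun s : ℝ≥0 => (s : ℝ))
      = (volume : Measure ℝ).restrict (Icc 0 t) := by
  have h : Iic t = (fun s : ℝ≥0 => (s : ℝ)) ⁻¹' Iic (t : ℝ) := by ext s; simp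
  rw [h, ← Measure.restrict_map measurableEmbedding_nnreal_coe.measurable measurableSet_Iic,
    map_coe_timeMeasure, Measure.restrict_restrict measurableSet_Iic, inter_comm, Ici_inter_Iic]

theorem timeMeasure_Iic (t : ℝ≥0) : timeMeasure (Iic t) = t := by
  have h := congrArg (fun m => m univ) (map_coe_timeMeasure_restrict_Iic t)
  rw [Measure.map_apply measurableEmbedding_nnreal_coe.measurable .univ] at h
  simpa using h

instance : SigmaFinite timeMeasure :=
  ⟨⟨{ set := fun n => Iic (n : ℝ≥0)
      set_mem := fun _ => trivial
      finite := fun n => by rw [timeMeasure_Iic]; exact ENNReal.coe_lt_top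
      spanning := by
        ext t
        simpa using exists_nat_ge t }⟩⟩

theorem setIntegral_timeMeasure_Iic {E : Type*} [NormedAddCommGroup E] [NormedSpace ℝ E]
    (f : ℝ≥0 → E) (t : ℝ≥0) :
    ∫ s in Iic t, f s ∂timeMeasure = ∫ s in (0 : ℝ)..t, f s.toNNReal := by
  rw [intervalIntegral.integral_of_le (NNReal.coe_nonneg t), ← integral_Icc_eq_integral_Ioc,
    ← map_coe_timeMeasure_restrict_Iic, measurableEmbedding_nnreal_coe.integral_map]
  simp

theorem setLIntegral_timeMeasure_Iic (f : ℝ≥0 → ℝ≥0∞) (t : ℝ≥0) :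
    ∫⁻ s in Iic t, f s ∂timeMeasure = ∫⁻ s in Icc (0 : ℝ) t, f s.toNNReal := by
  rw [← map_coe_timeMeasure_restrict_Iic, measurableEmbedding_nnreal_coe.lintegral_map]
  simp

theorem LipschitzWith.intervalIntegral_deriv_eq_sub {M : ℝ≥0} {f : ℝ → ℝ}
    (hf : LipschitzWith M f) (a b : ℝ) : ∫ t in a..b, deriv f t = f b - f a :=
  (hf.lipschitzOnWith (s := uIcc a b)).absolutelyContinuousOnInterval.integral_deriv_eq_sub

theorem LipschitzWith.intervalIntegrable_deriv {E : Type*} [NormedAddCommGroup E]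
    [NormedSpace ℝ E] [FiniteDimensional ℝ E] {M : ℝ≥0} {f : ℝ → E}
    (hf : LipschitzWith M f) (a b : ℝ) : IntervalIntegrable (deriv f) volume a b := by
  have := FiniteDimensional.complete ℝ E
  have h : IntervalIntegrable (fun _ : ℝ => (M : ℝ)) volume a b := intervalIntegrable_const
  refine h.mono_fun (aestronglyMeasurable_deriv f _) (Filter.Eventually.of_forall fun t => ?_)
  exact (norm_deriv_le_of_lipschitz hf).trans (le_abs_self _)

/-- Continuous functionals separate points, which reduces the claim to the scalar case. -/
theorem LipschitzWith.intervalIntegral_deriv_eq_sub' {E : Type*} [NormedAddCommGroup E]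
    [NormedSpace ℝ E] [FiniteDimensional ℝ E] {M : ℝ≥0}
    {f : ℝ → E} (hf : LipschitzWith M f) (a b : ℝ) : ∫ t in a..b, deriv f t = f b - f a := by
  have := FiniteDimensional.complete ℝ E
  refine (SeparatingDual.eq_iff_forall_dual_eq (R := ℝ)).2 fun g => ?_
  have hg := (g.lipschitz.comp hf).intervalIntegral_deriv_eq_sub a b
  simp only [Function.comp_apply] at hg
  rw [← g.intervalIntegral_comp_comm (hf.intervalIntegrable_deriv a b), map_sub, ← hg]
  refine intervalIntegral.integral_congr_ae ?_
  filter_upwards [hf.ae_differentiableAt_real] with t ht _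
  exact (g.hasFDerivAt.comp_hasDerivAt t ht.hasDerivAt).deriv.symm

/-! ### The compact metrizable space of Lipschitz curves. -/

/-- The `M`-Lipschitz curves starting in the closed ball of radius `R`, with the topology of
pointwise convergence. -/
def LipschitzCurves (E : Type*) [NormedAddCommGroup E] (M : ℝ≥0) (R : ℝ) : Set (ℝ → E) :=
  {w | LipschitzWith M w ∧ ‖w 0‖ ≤ R}

namespace LipschitzCurves

variable {E : Type*} [NormedAddCommGroup E] {M : ℝ≥0} {R : ℝ}

theorem isClosed : IsClosed (LipschitzCurves E M R) := by
  have : LipschitzCurves E M R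
      = (⋂ (s : ℝ) (t : ℝ), {w | dist (w s) (w t) ≤ M * dist s t}) ∩ {w | ‖w 0‖ ≤ R} := by
    ext w
    simp [LipschitzCurves, lipschitzWith_iff_dist_le_mul]
  rw [this]
  refine (isClosed_iInter fun s => isClosed_iInter fun t => ?_).inter ?_
  · exact isClosed_le ((continuous_apply s).dist (continuous_apply t)) continuous_const
  · exact isClosed_le (continuous_apply (0 : ℝ)).norm continuous_const

/-- Tychonoff: the value at `t` stays in the compact ball of radius `R + M * |t|`, and the defining
conditions are closed. -/
instance [ProperSpace E] : CompactSpace (LipschitzCurves E M R) := by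
  refine isCompact_iff_compactSpace.1 (IsCompact.of_isClosed_subset
    (isCompact_univ_pi fun t : ℝ => isCompact_closedBall (0 : E) (R + M * |t|)) isClosed ?_)
  rintro w ⟨hw, h0⟩ t -
  rw [mem_closedBall_zero_iff]
  have h1 := hw.dist_le_mul t 0
  rw [dist_eq_norm, Real.dist_eq, sub_zero] at h1
  linarith [norm_le_norm_add_norm_sub' (w t) (w 0)]

/-- Continuous curves are determined by their values at rational times, so this compact space embeds
in a countable product. -/
instance [ProperSpace E] : TopologicalSpace.MetrizableSpace (LipschitzCurves E M R) := by
  let F : LipschitzCurves E M R → ℚ → E := fun w q => w.1 q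
  have hF : Continuous F :=
    continuous_pi fun q => (continuous_apply (q : ℝ)).comp continuous_subtype_val
  have hinj : Function.Injective F := by
    intro w w' h
    refine Subtype.ext (Continuous.ext_on Rat.denseRange_cast w.2.1.continuous
      w'.2.1.continuous ?_)
    rintro _ ⟨q, rfl⟩
    exact congrFun h q
  exact (hF.isClosedEmbedding hinj).isEmbedding.metrizableSpace

/-- The common Lipschitz constant turns pointwise convergence into joint continuity in the curve and
the time. This is what makes arrival points and costs at variable end times continuous. -/
theorem continuous_eval :
    Continuous fun q : LipschitzCurves E M R × ℝ => q.1.1 q.2 :=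
  continuous_prod_of_continuous_lipschitzWith' _ M (fun w => w.2.1)
    fun t => (continuous_apply t).comp continuous_subtype_val

end LipschitzCurves

/-! ### Relaxed solutions: the weak form of the differential inclusion. -/

section Relaxed

variable {V W : Type*} [NormedAddCommGroup V] [NormedSpace ℝ V] [TopologicalSpace W]

/-- The lower Hamiltonian `inf_{u ∈ U} f(g(t, x, u))` of the controlled field `g` of velocities and
running costs. -/
noncomputable def lowerHamiltonian (g : ℝ → V → W → V × ℝ) (U : Set W) (f : StrongDual ℝ (V × ℝ))
    (q : ℝ × V) : ℝ :=
  sInf ((fun u => f (g q.1 q.2 u)) '' U)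

/-- The points `((t, x), (v, r))` such that velocity `v` with running cost at most `r` is
achieved at `(t, x)` by a control in `U`. -/
def velocityEpigraph (g : ℝ → V → W → V × ℝ) (U : Set W) : Set ((ℝ × V) × (V × ℝ)) :=
  {q | ∃ u ∈ U, (g q.1.1 q.1.2 u).1 = q.2.1 ∧ (g q.1.1 q.1.2 u).2 ≤ q.2.2}

/-- The curves `w = (γ, z)` whose increments satisfy the weak form of
`(γ', z') ∈ {(v, r) | ∃ u ∈ U, v = (g(t, γ, u)).1, (g(t, γ, u)).2 ≤ r}` on `[0, ∞)`. -/
def IsRelaxedSolution (g : ℝ → V → W → V × ℝ) (U : Set W) (w : ℝ → V × ℝ) : Prop :=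
  ∀ f : StrongDual ℝ (V × ℝ), 0 ≤ f (0, 1) → ∀ s t : ℝ, 0 ≤ s → s ≤ t →
    ∫ r in s..t, lowerHamiltonian g U f (r, (w r).1) ≤ f (w t - w s)

variable {g : ℝ → V → W → V × ℝ} {U : Set W}

theorem continuous_lowerHamiltonian
    (hg : Continuous fun q : ℝ × V × W => g q.1 q.2.1 q.2.2) (hU : IsCompact U)
    (f : StrongDual ℝ (V × ℝ)) : Continuous (lowerHamiltonian g U f) := by
  refine hU.continuous_sInf (f := fun (q : ℝ × V) u => f (g q.1 q.2 u)) ?_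
  exact f.continuous.comp (hg.comp (by fun_prop : Continuous fun p : (ℝ × V) × W =>
    (p.1.1, p.1.2, p.2)))

theorem isCompact_image_velocity
    (hg : Continuous fun q : ℝ × V × W => g q.1 q.2.1 q.2.2) (hU : IsCompact U)
    (f : StrongDual ℝ (V × ℝ)) (q : ℝ × V) : IsCompact ((fun u => f (g q.1 q.2 u)) '' U) :=
  hU.image (f.continuous.comp (hg.comp (by fun_prop : Continuous fun u : W => (q.1, q.2, u))))

theorem lowerHamiltonian_le
    (hg : Continuous fun q : ℝ × V × W => g q.1 q.2.1 q.2.2) (hU : IsCompact U)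
    (f : StrongDual ℝ (V × ℝ)) (q : ℝ × V) {u : W} (hu : u ∈ U) :
    lowerHamiltonian g U f q ≤ f (g q.1 q.2 u) :=
  csInf_le (isCompact_image_velocity hg hU f q).bddBelow (mem_image_of_mem _ hu)

theorem exists_eq_lowerHamiltonian
    (hg : Continuous fun q : ℝ × V × W => g q.1 q.2.1 q.2.2) (hU : IsCompact U)
    (hne : U.Nonempty) (f : StrongDual ℝ (V × ℝ)) (q : ℝ × V) :
    ∃ u ∈ U, f (g q.1 q.2 u) = lowerHamiltonian g U f q :=
  (isCompact_image_velocity hg hU f q).sInf_mem (hne.image _)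

theorem abs_lowerHamiltonian_le
    (hg : Continuous fun q : ℝ × V × W => g q.1 q.2.1 q.2.2) (hU : IsCompact U)
    (hne : U.Nonempty) {M : ℝ} (hM : ∀ t x, ∀ u ∈ U, ‖g t x u‖ ≤ M) (f : StrongDual ℝ (V × ℝ))
    (q : ℝ × V) : |lowerHamiltonian g U f q| ≤ ‖f‖ * M := by
  obtain ⟨u, hu, h⟩ := exists_eq_lowerHamiltonian hg hU hne f q
  rw [← h]
  exact (f.le_opNorm _).trans (mul_le_mul_of_nonneg_left (hM _ _ u hu) (norm_nonneg f))

/-- The second set, which keeps track of the control, is closed by continuity; the first is its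
projection along the compact `U`. -/
theorem isClosed_velocityEpigraph
    (hg : Continuous fun q : ℝ × V × W => g q.1 q.2.1 q.2.2) (hU : IsCompact U) :
    IsClosed (velocityEpigraph g U) ∧
    IsClosed {p : ((ℝ × V) × (V × ℝ)) × U |
      (g p.1.1.1 p.1.1.2 p.2).1 = p.1.2.1 ∧ (g p.1.1.1 p.1.1.2 p.2).2 ≤ p.1.2.2} := by
  have : CompactSpace U := isCompact_iff_compactSpace.1 hU
  have hc : Continuous fun p : ((ℝ × V) × (V × ℝ)) × U => g p.1.1.1 p.1.1.2 p.2 :=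
    hg.comp (by fun_prop : Continuous fun p : ((ℝ × V) × (V × ℝ)) × U =>
      (p.1.1.1, p.1.1.2, (p.2 : W)))
  have hcl : IsClosed {p : ((ℝ × V) × (V × ℝ)) × U |
      (g p.1.1.1 p.1.1.2 p.2).1 = p.1.2.1 ∧ (g p.1.1.1 p.1.1.2 p.2).2 ≤ p.1.2.2} :=
    (isClosed_eq hc.fst (by fun_prop)).inter (isClosed_le hc.snd (by fun_prop))
  refine ⟨?_, hcl⟩
  convert isClosedMap_fst_of_compactSpace _ hcl using 1
  ext q
  simp [velocityEpigraph, and_left_comm]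

/-- A Filippov selector. A single `σ` serves all curves, so the controls built from it inherit joint
measurability from the curves and their derivatives. -/
theorem exists_measurable_control [MeasurableSpace V] [BorelSpace V]
    [SecondCountableTopology V]
    [TopologicalSpace.MetrizableSpace W] [MeasurableSpace W] [BorelSpace W]
    (hg : Continuous fun q : ℝ × V × W => g q.1 q.2.1 q.2.2) (hU : IsCompact U)
    (hne : U.Nonempty) :
    ∃ σ : (ℝ × V) × (V × ℝ) → U, Measurable σ ∧ ∀ q ∈ velocityEpigraph g U,
      (g q.1.1 q.1.2 (σ q)).1 = q.2.1 ∧ (g q.1.1 q.1.2 (σ q)).2 ≤ q.2.2 := by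
  classical
  have : CompactSpace U := isCompact_iff_compactSpace.1 hU
  obtain ⟨hS, hG⟩ := isClosed_velocityEpigraph hg hU
  -- With a constant objective every point of the fiber is a minimizer, so this is a plain
  -- selection.
  obtain ⟨σ, hσ, h⟩ := exists_measurable_argmin (X := velocityEpigraph g U) (K := U)
    (hG.preimage (by fun_prop : Continuous fun p : velocityEpigraph g U × U => (p.1.1, p.2)))
    (by rintro ⟨q, u, hu, h⟩; exact ⟨⟨u, hu⟩, h⟩) (φ := fun _ => 0) continuous_const
  obtain ⟨u₀, hu₀⟩ := hne
  refine ⟨fun q => if hq : q ∈ velocityEpigraph g U then σ ⟨q, hq⟩ else ⟨u₀, hu₀⟩,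
    Measurable.dite hσ measurable_const hS.measurableSet, fun q hq => ?_⟩
  simp only [dif_pos hq]
  exact (h ⟨q, hq⟩).1

/-- Both sides of each defining inequality depend continuously on the curve, because derivatives do
not occur in them. -/
theorem isClosed_isRelaxedSolution {M : ℝ≥0} {R : ℝ}
    (hg : Continuous fun q : ℝ × V × W => g q.1 q.2.1 q.2.2) (hU : IsCompact U) :
    IsClosed {w : LipschitzCurves (V × ℝ) M R | IsRelaxedSolution g U w.1} := by
  simp only [IsRelaxedSolution, ofPred_forall]
  refine isClosed_iInter fun f => isClosed_iInter fun _ => isClosed_iInter fun s =>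
    isClosed_iInter fun t => isClosed_iInter fun _ => isClosed_iInter fun _ => isClosed_le ?_ ?_
  · refine intervalIntegral.continuous_parametric_intervalIntegral_of_continuous'
      (f := fun (w : LipschitzCurves (V × ℝ) M R) r =>
        lowerHamiltonian g U f (r, (w.1 r).1)) ?_ s t
    exact (continuous_lowerHamiltonian hg hU f).comp
      (continuous_snd.prodMk LipschitzCurves.continuous_eval.fst)
  · exact f.continuous.comp (((continuous_apply t).comp continuous_subtype_val).sub
      ((continuous_apply s).comp continuous_subtype_val))

theorem isRelaxedSolution_of_control [CompleteSpace V]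
    (hg : Continuous fun q : ℝ × V × W => g q.1 q.2.1 q.2.2) (hU : IsCompact U) {w : ℝ → V × ℝ}
    (hw : Continuous w) {c : ℝ → V × ℝ} (hc : ∀ s t : ℝ, IntervalIntegrable c volume s t)
    (hwc : ∀ s t : ℝ, 0 ≤ s → s ≤ t → w t - w s = ∫ r in s..t, c r)
    (h : ∀ r : ℝ, 0 ≤ r → ∃ u ∈ U, c r = g r (w r).1 u) : IsRelaxedSolution g U w := by
  intro f _ s t hs hst
  rw [hwc s t hs hst, ← f.intervalIntegral_comp_comm (hc s t)]
  refine intervalIntegral.integral_mono_on hst ?_ ?_ fun r hr => ?_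
  · exact ((continuous_lowerHamiltonian hg hU f).comp
      (continuous_id.prodMk hw.fst)).intervalIntegrable _ _
  · exact ⟨f.integrable_comp (hc s t).1, f.integrable_comp (hc s t).2⟩
  · obtain ⟨u, hu, hru⟩ := h r (hs.trans hr.1)
    rw [hru]
    exact lowerHamiltonian_le hg hU f _ hu

/-- Differentiating the weak inequalities at `t` gives `H_f ≤ f v` for every `f` with `f (0, 1) ≥
0`. Outside the closed convex epigraph, `v` would be strictly separated by such an `f`, a
contradiction. -/
theorem IsRelaxedSolution.mem_velocityEpigraph {w : ℝ → V × ℝ} (h : IsRelaxedSolution g U w)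
    (hg : Continuous fun q : ℝ × V × W => g q.1 q.2.1 q.2.2) (hU : IsCompact U)
    (hne : U.Nonempty)
    (hconv : ∀ t x, Convex ℝ {q : V × ℝ | ((t, x), q) ∈ velocityEpigraph g U})
    (hw : Continuous w) {t : ℝ} (ht : 0 ≤ t) {v : V × ℝ} (hv : HasDerivAt w v t) :
    ((t, (w t).1), v) ∈ velocityEpigraph g U := by
  have key : ∀ f : StrongDual ℝ (V × ℝ), 0 ≤ f (0, 1) →
      lowerHamiltonian g U f (t, (w t).1) ≤ f v := by
    intro f hf
    have hc : Continuous fun r => lowerHamiltonian g U f (r, (w r).1) :=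
      (continuous_lowerHamiltonian hg hU f).comp (continuous_id.prodMk hw.fst)
    -- The right difference quotients of this function at `t` are nonnegative by the weak
    -- inequality, hence so is its derivative.
    have hd : HasDerivAt (fun r => f (w r) - ∫ s in t..r, lowerHamiltonian g U f (s, (w s).1))
        (f v - lowerHamiltonian g U f (t, (w t).1)) t :=
      (f.hasFDerivAt.comp_hasDerivAt t hv).sub
        (intervalIntegral.integral_hasDerivAt_right (hc.intervalIntegrable _ _)
          (hc.stronglyMeasurableAtFilter _ _) hc.continuousAt)
    have hs := (hasDerivWithinAt_iff_tendsto_slope' (s := Ioi t) self_notMem_Ioi).1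
      hd.hasDerivWithinAt
    refine sub_nonneg.1 (ge_of_tendsto hs ?_)
    filter_upwards [self_mem_nhdsWithin] with r hr
    have hr' : t < r := hr
    have h1 := h f hf t r ht hr'.le
    rw [map_sub] at h1
    rw [slope_def_field, intervalIntegral.integral_same]
    exact div_nonneg (by linarith) (by linarith)
  by_contra hnot
  have hclosed : IsClosed {q : V × ℝ | ((t, (w t).1), q) ∈ velocityEpigraph g U} :=
    (isClosed_velocityEpigraph hg hU).1.preimage (Continuous.prodMk_right _)
  obtain ⟨f, a, hfv, hfa⟩ := geometric_hahn_banach_point_closed (hconv t (w t).1) hclosed hnot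
  -- The epigraph is unbounded upwards in the cost; a negative `f (0, 1)` would make `f` unbounded
  -- below on it.
  have hf : 0 ≤ f (0, 1) := by
    by_contra hneg
    obtain ⟨u, hu⟩ := hne
    have hmem : ∀ n : ℕ, a < f (g t (w t).1 u) + n * f (0, 1) := by
      intro n
      have := hfa (g t (w t).1 u + (n : ℝ) • ((0 : V), (1 : ℝ))) ⟨u, hu, by simp, by simp⟩
      rwa [map_add, map_smul, smul_eq_mul] at this
    obtain ⟨n, hn⟩ := exists_nat_gt ((f (g t (w t).1 u) - a) / (-f (0, 1)))
    rw [div_lt_iff₀ (by linarith)] at hn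
    linarith [hmem n]
  obtain ⟨u, hu, hue⟩ := exists_eq_lowerHamiltonian hg hU hne f (t, (w t).1)
  have h1 := hfa (g t (w t).1 u) ⟨u, hu, rfl, le_rfl⟩
  have h2 := key f hf
  simp only at hue
  linarith

/-- The weak inequality tested with the cost coordinate itself. -/
theorem IsRelaxedSolution.le_snd_sub {w : ℝ → V × ℝ} (h : IsRelaxedSolution g U w)
    (hg : Continuous fun q : ℝ × V × W => g q.1 q.2.1 q.2.2) (hU : IsCompact U)
    (hne : U.Nonempty) (hw : Continuous w) {β : ℝ} (hβ : ∀ t x, ∀ u ∈ U, β ≤ (g t x u).2)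
    {s t : ℝ} (hs : 0 ≤ s) (hst : s ≤ t) : β * (t - s) ≤ (w t).2 - (w s).2 := by
  have h1 := h (ContinuousLinearMap.snd ℝ V ℝ) (by simp) s t hs hst
  have h2 : ∫ _ in s..t, β
      ≤ ∫ r in s..t, lowerHamiltonian g U (ContinuousLinearMap.snd ℝ V ℝ) (r, (w r).1) := by
    refine intervalIntegral.integral_mono_on hst intervalIntegrable_const ?_ fun r _ => ?_
    · exact ((continuous_lowerHamiltonian hg hU _).comp
        (continuous_id.prodMk hw.fst)).intervalIntegrable _ _
    · obtain ⟨u, hu, hue⟩ := exists_eq_lowerHamiltonian hg hU hne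
        (ContinuousLinearMap.snd ℝ V ℝ) (r, (w r).1)
      rw [← hue]
      exact hβ _ _ u hu
  simp at h1 h2
  linarith

end Relaxed

/-! ### Controllability by limits of Euler polygons. -/

section Euler

variable {V W : Type*} [NormedAddCommGroup V] [InnerProductSpace ℝ V] [FiniteDimensional ℝ V]
  [TopologicalSpace W] {g : ℝ → V → W → V × ℝ} {U : Set W}

/-- Limits of curves driven by delayed controls are relaxed solutions. -/
theorem isRelaxedSolution_of_tendsto
    (hg : Continuous fun q : ℝ × V × W => g q.1 q.2.1 q.2.2) (hU : IsCompact U)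
    (hne : U.Nonempty) {M : ℝ≥0} {R : ℝ} (hM : ∀ t x, ∀ u ∈ U, ‖g t x u‖ ≤ M)
    {w : ℕ → LipschitzCurves (V × ℝ) M R} {w' : LipschitzCurves (V × ℝ) M R}
    (hlim : Filter.Tendsto w Filter.atTop (nhds w')) {c : ℕ → ℝ → V × ℝ}
    (hc : ∀ n s t, IntervalIntegrable (c n) volume s t)
    (hwc : ∀ n s t, 0 ≤ s → s ≤ t → (w n).1 t - (w n).1 s = ∫ r in s..t, c n r)
    {e : ℕ → ℝ → ℝ} (he : ∀ n, Measurable (e n))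
    (helim : ∀ r, 0 ≤ r → Filter.Tendsto (fun n => e n r) Filter.atTop (nhds r))
    (h : ∀ n r, 0 ≤ r → ∃ u ∈ U, c n r = g (e n r) ((w n).1 (e n r)).1 u) :
    IsRelaxedSolution g U w'.1 := by
  intro f _ s t hs hst
  have := FiniteDimensional.complete ℝ V
  have hH := continuous_lowerHamiltonian hg hU f
  have heval : ∀ r, Filter.Tendsto (fun n => (w n).1 r) Filter.atTop (nhds (w'.1 r)) := fun r =>
    (((continuous_apply r).comp continuous_subtype_val).tendsto w').comp hlim
  have hmeas : ∀ n, Measurable fun r => lowerHamiltonian g U f (e n r, ((w n).1 (e n r)).1) := by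
    intro n
    exact (hH.comp (continuous_id.prodMk (w n).2.1.continuous.fst)).measurable.comp (he n)
  have hbound : ∀ n r, ‖lowerHamiltonian g U f (e n r, ((w n).1 (e n r)).1)‖ ≤ ‖f‖ * M :=
    fun n r => abs_lowerHamiltonian_le hg hU hne hM f _
  have hle : ∀ n, ∫ r in s..t, lowerHamiltonian g U f (e n r, ((w n).1 (e n r)).1)
      ≤ f ((w n).1 t - (w n).1 s) := by
    intro n
    rw [hwc n s t hs hst, ← f.intervalIntegral_comp_comm (hc n s t)]
    refine intervalIntegral.integral_mono_on hst ?_ ?_ fun r hr => ?_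
    · have hi : IntervalIntegrable (fun _ : ℝ => ‖f‖ * (M : ℝ)) volume s t :=
        intervalIntegrable_const
      refine hi.mono_fun (hmeas n).aestronglyMeasurable
        (Filter.Eventually.of_forall fun r => (hbound n r).trans (le_abs_self _))
    · exact ⟨f.integrable_comp (hc n s t).1, f.integrable_comp (hc n s t).2⟩
    · obtain ⟨u, hu, hru⟩ := h n r (hs.trans hr.1)
      rw [hru]
      exact lowerHamiltonian_le hg hU f _ hu
  -- The delayed times tend to `r` and evaluation is jointly continuous, so the integrands converge
  -- pointwise; they are dominated by `‖f‖ * M`.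
  refine le_of_tendsto_of_tendsto' ?_ ((f.continuous.tendsto _).comp
    ((heval t).sub (heval s))) hle
  refine intervalIntegral.tendsto_integral_filter_of_dominated_convergence
    (fun _ => ‖f‖ * (M : ℝ)) (Filter.Eventually.of_forall fun n => (hmeas n).aestronglyMeasurable)
    (Filter.Eventually.of_forall fun n => Filter.Eventually.of_forall fun r _ => hbound n r)
    intervalIntegrable_const (Filter.Eventually.of_forall fun r hr => ?_)
  rw [uIoc_of_le hst] at hr
  have her := helim r (hs.trans hr.1.le)
  refine (hH.tendsto _).comp (her.prodMk_nhds ?_)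
  exact (continuous_fst.tendsto _).comp
    ((LipschitzCurves.continuous_eval.tendsto (w', r)).comp (hlim.prodMk_nhds her))

/-- The nodes of the Euler polygon of mesh `h` for the field `g` with feedback control `φ`. -/
noncomputable def eulerNode (g : ℝ → V → W → V × ℝ) (φ : ℝ → V → W) (h : ℝ) (x : V) : ℕ → V × ℝ
  | 0 => (x, 0)
  | j + 1 => eulerNode g φ h x j + h • g (j * h) (eulerNode g φ h x j).1
      (φ (j * h) (eulerNode g φ h x j).1)

/-- The derivative of the Euler polygon. -/
noncomputable def eulerVelocity (g : ℝ → V → W → V × ℝ) (φ : ℝ → V → W) (h : ℝ) (x : V) (r : ℝ) :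
    V × ℝ :=
  g (⌊r / h⌋₊ * h) (eulerNode g φ h x ⌊r / h⌋₊).1
    (φ (⌊r / h⌋₊ * h) (eulerNode g φ h x ⌊r / h⌋₊).1)

/-- The Euler polygon. -/
noncomputable def eulerPolygon (g : ℝ → V → W → V × ℝ) (φ : ℝ → V → W) (h : ℝ) (x : V) (t : ℝ) :
    V × ℝ :=
  (x, 0) + ∫ r in (0 : ℝ)..t, eulerVelocity g φ h x r

theorem intervalIntegrable_eulerVelocity {M : ℝ≥0} (hM : ∀ t x, ∀ u ∈ U, ‖g t x u‖ ≤ M)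
    {φ : ℝ → V → W} (hφ : ∀ t x, φ t x ∈ U) (h : ℝ) (x : V) (s t : ℝ) :
    IntervalIntegrable (eulerVelocity g φ h x) volume s t := by
  have hi : IntervalIntegrable (fun _ : ℝ => (M : ℝ)) volume s t := intervalIntegrable_const
  refine hi.mono_fun (StronglyMeasurable.aestronglyMeasurable ?_)
    (Filter.Eventually.of_forall fun r => (hM _ _ _ (hφ _ _)).trans (le_abs_self _))
  have hF : StronglyMeasurable fun j : ℕ => g (j * h) (eulerNode g φ h x j).1
      (φ (j * h) (eulerNode g φ h x j).1) := StronglyMeasurable.of_discrete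
  exact hF.comp_measurable (Nat.measurable_floor.comp (measurable_id.div_const h))

theorem eulerPolygon_sub {M : ℝ≥0} (hM : ∀ t x, ∀ u ∈ U, ‖g t x u‖ ≤ M)
    {φ : ℝ → V → W} (hφ : ∀ t x, φ t x ∈ U) (h : ℝ) (x : V) (s t : ℝ) :
    eulerPolygon g φ h x t - eulerPolygon g φ h x s = ∫ r in s..t, eulerVelocity g φ h x r := by
  rw [eulerPolygon, eulerPolygon, add_sub_add_left_eq_sub]
  exact intervalIntegral.integral_interval_sub_left
    (intervalIntegrable_eulerVelocity hM hφ h x _ _)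
    (intervalIntegrable_eulerVelocity hM hφ h x _ _)

theorem lipschitzWith_eulerPolygon {M : ℝ≥0} (hM : ∀ t x, ∀ u ∈ U, ‖g t x u‖ ≤ M)
    {φ : ℝ → V → W} (hφ : ∀ t x, φ t x ∈ U) (h : ℝ) (x : V) :
    LipschitzWith M (eulerPolygon g φ h x) := by
  refine LipschitzWith.of_dist_le_mul fun s t => ?_
  rw [dist_eq_norm, eulerPolygon_sub hM hφ, Real.dist_eq]
  exact intervalIntegral.norm_integral_le_of_norm_le_const fun r _ => hM _ _ _ (hφ _ _)

theorem eulerPolygon_node {M : ℝ≥0} (hM : ∀ t x, ∀ u ∈ U, ‖g t x u‖ ≤ M)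
    {φ : ℝ → V → W} (hφ : ∀ t x, φ t x ∈ U) {h : ℝ} (hh : 0 < h) (x : V) (j : ℕ) :
    eulerPolygon g φ h x (j * h) = eulerNode g φ h x j := by
  have := FiniteDimensional.complete ℝ V
  induction j with
  | zero => simp [eulerPolygon, eulerNode]
  | succ j ih =>
    have h1 := eulerPolygon_sub hM hφ h x (j * h) ((j + 1 : ℕ) * h)
    have hle : (j : ℝ) * h ≤ (j + 1 : ℕ) * h := by push_cast; nlinarith
    have h2 : ∫ r in (j * h : ℝ)..((j + 1 : ℕ) * h), eulerVelocity g φ h x r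
        = ∫ r in (j * h : ℝ)..((j + 1 : ℕ) * h), g (j * h) (eulerNode g φ h x j).1
          (φ (j * h) (eulerNode g φ h x j).1) := by
      refine intervalIntegral.integral_congr_ae ?_
      -- The floor jumps at the right endpoint, a null set.
      have hne : ∀ᵐ r : ℝ, r ≠ (j + 1 : ℕ) * h := by simp [ae_iff, measure_singleton]
      filter_upwards [hne] with r hr hmem
      rw [uIoc_of_le hle] at hmem
      have hfl : ⌊r / h⌋₊ = j := by
        rw [Nat.floor_eq_iff (div_nonneg ((by positivity : (0 : ℝ) ≤ j * h).trans hmem.1.le) hh.le),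
          le_div_iff₀ hh, div_lt_iff₀ hh]
        refine ⟨hmem.1.le, ?_⟩
        have := lt_of_le_of_ne hmem.2 hr
        push_cast at this
        exact this
      rw [eulerVelocity, hfl]
    rw [h2, intervalIntegral.integral_const, ih, sub_eq_iff_eq_add'] at h1
    rw [h1, eulerNode]
    congr 2
    push_cast
    ring

/-- A discrete feedback with inward velocities of speed at least `α` comes close to `y`. -/
theorem exists_norm_eulerNode_sub_lt {M : ℝ≥0} (hM : ∀ t x, ∀ u ∈ U, ‖g t x u‖ ≤ M)
    {φ : ℝ → V → W} (hφ : ∀ t x, φ t x ∈ U) {α : ℝ} (hα : 0 < α) {y : V}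
    (hin : ∀ t x, inner ℝ (g t x (φ t x)).1 (x - y) ≤ -α * ‖x - y‖) {h δ : ℝ} (hh : 0 < h)
    (hδ : 0 < δ) (hhδ : h * (M : ℝ) ^ 2 ≤ α * δ) (x : V) {N : ℕ}
    (hN : ‖x - y‖ ≤ N * (α * h / 2)) :
    ∃ j ≤ N, ‖(eulerNode g φ h x j).1 - y‖ < δ := by
  by_contra! hcon
  have hstep : ∀ j ≤ N, ‖(eulerNode g φ h x j).1 - y‖ ≤ ‖x - y‖ - j * (α * h / 2) := by
    intro j
    induction j with
    | zero => intro _; simp [eulerNode]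
    | succ j ih =>
      intro hj
      have hb := hcon j (by omega)
      refine le_trans ?_ (by push_cast; linarith [ih (by omega)] :
        ‖(eulerNode g φ h x j).1 - y‖ - α * h / 2 ≤ ‖x - y‖ - (j + 1 : ℕ) * (α * h / 2))
      set a := (eulerNode g φ h x j).1 with ha
      set v := g (j * h) a (φ (j * h) a) with hv
      have hnode : (eulerNode g φ h x (j + 1)).1 - y = (a - y) + h • v.1 := by
        rw [eulerNode, Prod.fst_add, Prod.smul_fst]
        abel
      have hvn : ‖v.1‖ ≤ M := (norm_fst_le v).trans (hM _ _ _ (hφ _ _))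
      have hvi : inner ℝ v.1 (a - y) ≤ -α * ‖a - y‖ := hin _ _
      -- The cross term gains `2 * α * h * ‖a - y‖`; the smallness of the mesh and `δ ≤ ‖a - y‖` let
      -- the quadratic term consume at most half of it.
      have hsq : ‖(a - y) + h • v.1‖ ^ 2 ≤ ‖a - y‖ ^ 2 - α * h * ‖a - y‖ := by
        rw [norm_add_sq_real, inner_smul_right, real_inner_comm, norm_smul, mul_pow,
          Real.norm_of_nonneg hh.le]
        have h1 : ‖v.1‖ ^ 2 ≤ (M : ℝ) ^ 2 := pow_le_pow_left₀ (norm_nonneg _) hvn 2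
        have h2 : h ^ 2 * ‖v.1‖ ^ 2 ≤ h * (α * ‖a - y‖) := by
          calc h ^ 2 * ‖v.1‖ ^ 2 ≤ h ^ 2 * (M : ℝ) ^ 2 := by gcongr
            _ = h * (h * (M : ℝ) ^ 2) := by ring
            _ ≤ h * (α * ‖a - y‖) :=
              mul_le_mul_of_nonneg_left
                (hhδ.trans (mul_le_mul_of_nonneg_left hb hα.le)) hh.le
        have h3 := mul_le_mul_of_nonneg_left hvi hh.le
        nlinarith
      have hpos : 0 < ‖a - y‖ := hδ.trans_le hb
      -- Otherwise `hsq` would make a square negative. This gives `‖a - y‖ - α * h / 2 ≥ 0`, needed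
      -- to compare squares.
      have hge : α * h ≤ ‖a - y‖ := by
        by_contra! hlt
        nlinarith [sq_nonneg ‖(a - y) + h • v.1‖]
      rw [hnode]
      refine abs_le_of_sq_le_sq' ?_ (by nlinarith [mul_pos hα hh]) |>.2
      nlinarith [sq_nonneg (α * h)]
  have h1 := hstep N le_rfl
  have h2 := hcon N le_rfl
  linarith

/-- Any two points are joined by a relaxed solution, in a time controlled by their distance. -/
theorem exists_isRelaxedSolution_reaching
    (hg : Continuous fun q : ℝ × V × W => g q.1 q.2.1 q.2.2) (hU : IsCompact U) {M : ℝ≥0}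
    (hM : ∀ t x, ∀ u ∈ U, ‖g t x u‖ ≤ M) {α : ℝ} (hα : 0 < α)
    (hin : ∀ t x v, ∃ u ∈ U, inner ℝ (g t x u).1 v ≤ -α * ‖v‖) (x y : V) :
    ∃ w : ℝ → V × ℝ, LipschitzWith M w ∧ w 0 = (x, 0) ∧ IsRelaxedSolution g U w ∧
      ∃ τ ∈ Icc 0 (2 * ‖x - y‖ / α + α), (w τ).1 = y := by
  choose φ' hφ' hin' using hin
  let φ : ℝ → V → W := fun t z => φ' t z (z - y)
  have hφ : ∀ t z, φ t z ∈ U := fun t z => hφ' t z _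
  have hne : U.Nonempty := ⟨_, hφ 0 0⟩
  -- The mesh is chosen so that `h n ≤ α` and `h n * M ^ 2 ≤ α / (n + 1)`, the smallness required to
  -- come within `1 / (n + 1)` of `y`.
  let h : ℕ → ℝ := fun n => α / ((M : ℝ) ^ 2 + 1) * (1 / ((n : ℝ) + 1))
  have hh : ∀ n, 0 < h n := fun n => by positivity
  have hhα : ∀ n, h n ≤ α := fun n => by
    have h1 : α / ((M : ℝ) ^ 2 + 1) ≤ α := div_le_self hα.le (by nlinarith [sq_nonneg (M : ℝ)])
    have h2 : 1 / ((n : ℝ) + 1) ≤ 1 := by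
      rw [div_le_one (by positivity)]
      linarith [n.cast_nonneg (α := ℝ)]
    calc h n ≤ α * 1 := mul_le_mul h1 h2 (by positivity) hα.le
      _ = α := mul_one α
  have hlim0 : Filter.Tendsto h Filter.atTop (nhds 0) := by
    simpa [h] using (tendsto_one_div_add_atTop_nhds_zero_nat (𝕜 := ℝ)).const_mul
      (α / ((M : ℝ) ^ 2 + 1))
  have hclose : ∀ n, ∃ τ ∈ Icc 0 (2 * ‖x - y‖ / α + α),
      ‖(eulerPolygon g φ (h n) x τ).1 - y‖ < 1 / ((n : ℝ) + 1) := by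
    intro n
    let N := ⌈2 * ‖x - y‖ / (α * h n)⌉₊
    have hαh : 0 < α * h n := mul_pos hα (hh n)
    have hN : ‖x - y‖ ≤ N * (α * h n / 2) := by
      have := Nat.le_ceil (2 * ‖x - y‖ / (α * h n))
      rw [div_le_iff₀ hαh] at this
      linarith
    have hN' : N * h n ≤ 2 * ‖x - y‖ / α + α := by
      have := (Nat.ceil_lt_add_one (by positivity : 0 ≤ 2 * ‖x - y‖ / (α * h n))).le
      calc (N : ℝ) * h n ≤ (2 * ‖x - y‖ / (α * h n) + 1) * h n :=
            mul_le_mul_of_nonneg_right this (hh n).le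
        _ = 2 * ‖x - y‖ / α + h n := by
          have := (hh n).ne'
          field_simp
        _ ≤ _ := by linarith [hhα n]
    obtain ⟨j, hj, hlt⟩ := exists_norm_eulerNode_sub_lt hM hφ hα (fun t z => hin' t z (z - y))
      (hh n) (by positivity : 0 < 1 / ((n : ℝ) + 1)) (by
        have : α / ((M : ℝ) ^ 2 + 1) * (M : ℝ) ^ 2 ≤ α := by
          rw [div_mul_eq_mul_div, div_le_iff₀ (by positivity)]
          nlinarith
        calc h n * (M : ℝ) ^ 2
            = α / ((M : ℝ) ^ 2 + 1) * (M : ℝ) ^ 2 * (1 / ((n : ℝ) + 1)) := by ring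
          _ ≤ _ := by gcongr) x hN
    refine ⟨j * h n, ⟨by have := hh n; positivity, le_trans ?_ hN'⟩, ?_⟩
    · have : (j : ℝ) ≤ N := by exact_mod_cast hj
      exact mul_le_mul_of_nonneg_right this (hh n).le
    · rwa [eulerPolygon_node hM hφ (hh n)]
  choose τ hτ hτy using hclose
  let w : ℕ → LipschitzCurves (V × ℝ) M ‖x‖ := fun n =>
    ⟨eulerPolygon g φ (h n) x, lipschitzWith_eulerPolygon hM hφ (h n) x, by simp [eulerPolygon]⟩
  have : ProperSpace V := FiniteDimensional.proper ℝ V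
  obtain ⟨⟨w', τ'⟩, ν, hν, hlim⟩ := CompactSpace.tendsto_subseq
    fun n => (w n, (⟨τ n, hτ n⟩ : Icc 0 (2 * ‖x - y‖ / α + α)))
  have hlimw : Filter.Tendsto (fun n => w (ν n)) Filter.atTop (nhds w') :=
    (continuous_fst.tendsto _).comp hlim
  have hlimτ : Filter.Tendsto (fun n => τ (ν n)) Filter.atTop (nhds τ') :=
    ((continuous_subtype_val.comp continuous_snd).tendsto _).comp hlim
  refine ⟨w'.1, w'.2.1, ?_, ?_, τ'.1, τ'.2, ?_⟩
  · have h1 := (((continuous_apply (0 : ℝ)).comp continuous_subtype_val).tendsto w').comp hlimw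
    refine tendsto_nhds_unique h1 (tendsto_const_nhds.congr fun n => ?_)
    simp [w, eulerPolygon]
  · refine isRelaxedSolution_of_tendsto hg hU hne hM hlimw
      (c := fun n => eulerVelocity g φ (h (ν n)) x)
      (fun n s t => intervalIntegrable_eulerVelocity hM hφ _ x s t)
      (fun n s t _ _ => eulerPolygon_sub hM hφ _ x s t)
      -- The velocity at `r` is computed at the preceding node; this delay is at most one mesh.
      (e := fun n r => ⌊r / h (ν n)⌋₊ * h (ν n)) (fun n => ?_) (fun r hr => ?_) fun n r _ => ?_
    · exact (measurable_from_top.comp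
        (Nat.measurable_floor.comp (measurable_id.div_const _))).mul_const _
    · have hν0 := hlim0.comp hν.tendsto_atTop
      have hlow : Filter.Tendsto (fun n => r - h (ν n)) Filter.atTop (nhds r) := by
        simpa using tendsto_const_nhds.sub hν0
      refine tendsto_of_tendsto_of_tendsto_of_le_of_le hlow tendsto_const_nhds
        (fun n => ?_) fun n => ?_
      · have h1 := (Nat.lt_floor_add_one (r / h (ν n))).le
        rw [div_le_iff₀ (hh _)] at h1
        simp only
        linarith
      · have h1 := Nat.floor_le (div_nonneg hr (hh (ν n)).le)
        rwa [le_div_iff₀ (hh _)] at h1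
    · refine ⟨φ (⌊r / h (ν n)⌋₊ * h (ν n)) (eulerNode g φ (h (ν n)) x ⌊r / h (ν n)⌋₊).1,
        hφ _ _, ?_⟩
      simp only [w]
      rw [eulerPolygon_node hM hφ (hh _)]
      rfl
  · have h1 : Filter.Tendsto (fun n => ((w (ν n)).1 (τ (ν n))).1) Filter.atTop
        (nhds (w'.1 τ').1) :=
      (continuous_fst.tendsto _).comp ((LipschitzCurves.continuous_eval.tendsto (w', τ'.1)).comp
        (hlimw.prodMk_nhds hlimτ))
    refine tendsto_nhds_unique h1 (tendsto_iff_norm_sub_tendsto_zero.2 ?_)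
    refine squeeze_zero (fun n => norm_nonneg _) (fun n => (hτy (ν n)).le) ?_
    exact (tendsto_one_div_add_atTop_nhds_zero_nat (𝕜 := ℝ)).comp hν.tendsto_atTop

end Euler

/-! ### Passage between controlled trajectories and relaxed solutions. -/

section Optimal

variable {d : ℕ}

theorem hittingTimeOf_le {γ : ℝ≥0 → StateSpace d} {y : StateSpace d} {s : ℝ≥0} (h : γ s = y) :
    hittingTimeOf γ y ≤ s :=
  iInf₂_le s h

theorem exists_hittingTimeOf_eq {γ : ℝ≥0 → StateSpace d} (hγ : Continuous γ) {y : StateSpace d}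
    (h : ∃ s, γ s = y) : ∃ τ : ℝ≥0, hittingTimeOf γ y = τ ∧ γ τ = y := by
  have hmem : sInf {s | γ s = y} ∈ {s | γ s = y} :=
    (isClosed_singleton.preimage hγ : IsClosed {s | γ s = y}).csInf_mem h (OrderBot.bddBelow _)
  refine ⟨sInf {s | γ s = y}, le_antisymm (hittingTimeOf_le hmem) ?_, hmem⟩
  exact le_iInf₂ fun s hs => ENNReal.coe_le_coe.2 (csInf_le (OrderBot.bddBelow _) hs)

theorem runningCost_eq_setLIntegral_Iic (L : ℝ≥0 → StateSpace d → StateSpace d → ℝ≥0)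
    {U : Set (StateSpace d)} (u : ℝ≥0 → U) (γ : ℝ≥0 → StateSpace d) {y : StateSpace d} {τ : ℝ≥0}
    (h : hittingTimeOf γ y = τ) :
    runningCost L u γ y = ∫⁻ s in Iic τ, (L s (γ s) (u s) : ℝ≥0∞) ∂timeMeasure := by
  have : {s : ℝ≥0 | (s : ℝ≥0∞) < hittingTimeOf γ y} = Iio τ := by
    ext s
    simp [h]
  rw [runningCost, this]
  exact setLIntegral_congr Iio_ae_eq_Iic

/-- A trajectory that never arrives pays at least `β` per unit of time forever; by time `r / β` it
has paid `r`. -/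
theorem runningCost_eq_top (L : ℝ≥0 → StateSpace d → StateSpace d → ℝ≥0)
    {U : Set (StateSpace d)} {β : ℝ≥0} (hβ : 0 < β) (hL : ∀ t x, ∀ u ∈ U, β ≤ L t x u)
    (u : ℝ≥0 → U) (γ : ℝ≥0 → StateSpace d) {y : StateSpace d} (h : ¬ ∃ s, γ s = y) :
    runningCost L u γ y = ⊤ := by
  have htop : hittingTimeOf γ y = ⊤ := by
    refine iInf₂_eq_top.2 fun s hs => (h ⟨s, hs⟩).elim
  have huniv : {s : ℝ≥0 | (s : ℝ≥0∞) < hittingTimeOf γ y} = univ := by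
    ext s
    simp [htop]
  rw [runningCost, huniv, Measure.restrict_univ]
  refine ENNReal.eq_top_of_forall_nnreal_le fun r => ?_
  calc (r : ℝ≥0∞) = β * timeMeasure (Iic (r / β)) := by
        rw [timeMeasure_Iic, ← ENNReal.coe_mul, mul_div_cancel₀ _ hβ.ne']
    _ = ∫⁻ _ in Iic (r / β), (β : ℝ≥0∞) ∂timeMeasure := by rw [setLIntegral_const]
    _ ≤ ∫⁻ s in Iic (r / β), (L s (γ s) (u s) : ℝ≥0∞) ∂timeMeasure :=
        lintegral_mono fun s => ENNReal.coe_le_coe.2 (hL _ _ _ (u s).2)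
    _ ≤ _ := setLIntegral_le_lintegral _ _

/-- The field of velocities and running costs, extended to all real times. -/
noncomputable def velocityCost (k : ℝ≥0 → StateSpace d → StateSpace d → StateSpace d)
    (L : ℝ≥0 → StateSpace d → StateSpace d → ℝ≥0) (t : ℝ) (x u : StateSpace d) :
    StateSpace d × ℝ :=
  (k t.toNNReal x u, (L t.toNNReal x u : ℝ))

variable {k : ℝ≥0 → StateSpace d → StateSpace d → StateSpace d}
  {L : ℝ≥0 → StateSpace d → StateSpace d → ℝ≥0} {U : Set (StateSpace d)}

theorem continuous_velocityCost
    (hk : Continuous fun q : ℝ≥0 × StateSpace d × StateSpace d => k q.1 q.2.1 q.2.2)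
    (hL : Continuous fun q : ℝ≥0 × StateSpace d × StateSpace d => L q.1 q.2.1 q.2.2) :
    Continuous fun q : ℝ × StateSpace d × StateSpace d => velocityCost k L q.1 q.2.1 q.2.2 := by
  have h : Continuous fun q : ℝ × StateSpace d × StateSpace d => (q.1.toNNReal, q.2) :=
    (continuous_real_toNNReal.comp continuous_fst).prodMk continuous_snd
  exact (hk.comp h).prodMk (NNReal.continuous_coe.comp (hL.comp h))

/-- An admissible trajectory, together with its accumulated cost, is a relaxed solution. -/
theorem IsAdmissibleTrajectory.exists_isRelaxedSolution
    (hk : Continuous fun q : ℝ≥0 × StateSpace d × StateSpace d => k q.1 q.2.1 q.2.2)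
    (hL : Continuous fun q : ℝ≥0 × StateSpace d × StateSpace d => L q.1 q.2.1 q.2.2)
    (hU : IsCompact U) {M : ℝ≥0} (hM : ∀ t x, ∀ u ∈ U, ‖velocityCost k L t x u‖ ≤ M)
    {x : StateSpace d} {u : ℝ≥0 → U} {γ : ℝ≥0 → StateSpace d}
    (h : IsAdmissibleTrajectory k U x u γ) :
    ∃ w : ℝ → StateSpace d × ℝ, LipschitzWith M w ∧ w 0 = (x, 0) ∧
      IsRelaxedSolution (velocityCost k L) U w ∧ ∀ τ : ℝ≥0, (w τ).1 = γ τ ∧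
        ENNReal.ofReal (w τ).2 = ∫⁻ s in Iic τ, (L s (γ s) (u s) : ℝ≥0∞) ∂timeMeasure := by
  have hg := continuous_velocityCost hk hL
  let c : ℝ → StateSpace d × ℝ := fun r => velocityCost k L r (γ r.toNNReal) (u r.toNNReal)
  have hcM : ∀ r, ‖c r‖ ≤ M := fun r => hM _ _ _ (u r.toNNReal).2
  have hcm : Measurable c := hg.measurable.comp (measurable_id.prodMk
    ((h.continuous.measurable.comp measurable_real_toNNReal).prodMk
      (measurable_subtype_coe.comp (h.measurable_control.comp measurable_real_toNNReal))))
  have hci : ∀ s t, IntervalIntegrable c volume s t := fun s t => by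
    have hi : IntervalIntegrable (fun _ : ℝ => (M : ℝ)) volume s t := intervalIntegrable_const
    exact hi.mono_fun hcm.aestronglyMeasurable
      (Filter.Eventually.of_forall fun r => (hcM r).trans (le_abs_self _))
  let w : ℝ → StateSpace d × ℝ := fun t => (x, 0) + ∫ r in (0 : ℝ)..t, c r
  have hsub : ∀ s t, w t - w s = ∫ r in s..t, c r := fun s t => by
    simp only [w, add_sub_add_left_eq_sub]
    exact intervalIntegral.integral_interval_sub_left (hci _ _) (hci _ _)
  have hlip : LipschitzWith M w := LipschitzWith.of_dist_le_mul fun s t => by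
    rw [dist_eq_norm, hsub, Real.dist_eq]
    exact intervalIntegral.norm_integral_le_of_norm_le_const fun r _ => hcM r
  have hfst : ∀ τ : ℝ≥0, (w τ).1 = γ τ := by
    intro τ
    have h1 := (ContinuousLinearMap.fst ℝ (StateSpace d) ℝ).intervalIntegral_comp_comm
      (hci 0 τ)
    rw [h.integral_eq τ, setIntegral_timeMeasure_Iic]
    simp only [w, Prod.fst_add]
    congr 1
    rw [ContinuousLinearMap.coe_fst'] at h1
    exact h1.symm
  refine ⟨w, hlip, by simp [w], isRelaxedSolution_of_control hg hU hlip.continuous hci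
    (fun s t _ _ => hsub s t) fun r hr => ⟨u r.toNNReal, (u r.toNNReal).2, ?_⟩,
    fun τ => ⟨hfst τ, ?_⟩⟩
  · have := hfst r.toNNReal
    rw [Real.coe_toNNReal r hr] at this
    simp only [c, this]
  · have h1 := (ContinuousLinearMap.snd ℝ (StateSpace d) ℝ).intervalIntegral_comp_comm
      (hci 0 τ)
    rw [ContinuousLinearMap.coe_snd'] at h1
    have h2 : (w τ).2 = ∫ r in (0 : ℝ)..τ, (c r).2 := by
      rw [h1]
      simp [w]
    rw [h2, intervalIntegral.integral_of_le (NNReal.coe_nonneg τ),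
      ← integral_Icc_eq_integral_Ioc, ofReal_integral_eq_lintegral_ofReal,
      setLIntegral_timeMeasure_Iic]
    · refine lintegral_congr fun r => ?_
      simp [c, velocityCost]
    · have := (intervalIntegrable_iff_integrableOn_Icc_of_le (NNReal.coe_nonneg τ)).1 (hci 0 τ)
      exact (ContinuousLinearMap.snd ℝ (StateSpace d) ℝ).integrable_comp this
    · exact Filter.Eventually.of_forall fun r => by simp [c, velocityCost]

/-- A relaxed solution is driven by the control selected by `σ`, at no greater cost. -/
theorem IsRelaxedSolution.isAdmissibleTrajectory
    (hk : Continuous fun q : ℝ≥0 × StateSpace d × StateSpace d => k q.1 q.2.1 q.2.2)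
    (hL : Continuous fun q : ℝ≥0 × StateSpace d × StateSpace d => L q.1 q.2.1 q.2.2)
    (hU : IsCompact U) (hne : U.Nonempty)
    (hconv : ∀ t x, Convex ℝ
      {q : StateSpace d × ℝ | ((t, x), q) ∈ velocityEpigraph (velocityCost k L) U})
    {σ : (ℝ × StateSpace d) × (StateSpace d × ℝ) → U} (hσ : Measurable σ)
    (hσ' : ∀ q ∈ velocityEpigraph (velocityCost k L) U,
      (velocityCost k L q.1.1 q.1.2 (σ q)).1 = q.2.1 ∧
      (velocityCost k L q.1.1 q.1.2 (σ q)).2 ≤ q.2.2)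
    {M : ℝ≥0} {w : ℝ → StateSpace d × ℝ} (hw : LipschitzWith M w)
    (h : IsRelaxedSolution (velocityCost k L) U w) :
    IsAdmissibleTrajectory k U (w 0).1 (fun t => σ ((t, (w t).1), deriv w t)) (fun t => (w t).1) ∧
    ∀ τ : ℝ≥0, ∫⁻ s in Iic τ, (L s (w s).1 (σ ((s, (w s).1), deriv w s)) : ℝ≥0∞) ∂timeMeasure
      ≤ ENNReal.ofReal ((w τ).2 - (w 0).2) := by
  have hg := continuous_velocityCost hk hL
  -- At almost every time the derivative exists and lies in the epigraph, where `σ` reproduces the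
  -- velocity exactly and the cost up to an inequality.
  have hmem : ∀ᵐ t : ℝ, 0 ≤ t →
      ((t, (w t).1), deriv w t) ∈ velocityEpigraph (velocityCost k L) U := by
    filter_upwards [hw.ae_differentiableAt_real] with t ht h0
    exact h.mem_velocityEpigraph hg hU hne hconv hw.continuous h0 ht.hasDerivAt
  refine ⟨⟨?_, hw.continuous.fst.comp NNReal.continuous_coe, fun t => ?_⟩, fun τ => ?_⟩
  · exact hσ.comp ((measurable_coe_nnreal_real.prodMk
      (hw.continuous.fst.comp NNReal.continuous_coe).measurable).prodMk
      ((measurable_deriv w).comp measurable_coe_nnreal_real))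
  · have h1 := (ContinuousLinearMap.fst ℝ (StateSpace d) ℝ).intervalIntegral_comp_comm
      (hw.intervalIntegrable_deriv 0 t)
    rw [ContinuousLinearMap.coe_fst', hw.intervalIntegral_deriv_eq_sub', Prod.fst_sub] at h1
    rw [setIntegral_timeMeasure_Iic, ← sub_eq_iff_eq_add', ← h1]
    refine intervalIntegral.integral_congr_ae ?_
    filter_upwards [hmem] with r hr hrt
    rw [uIoc_of_le (NNReal.coe_nonneg t)] at hrt
    have h2 := (hσ' _ (hr hrt.1.le)).1
    simp only [velocityCost] at h2
    rw [Real.coe_toNNReal r hrt.1.le]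
    exact h2.symm
  · have h1 := (ContinuousLinearMap.snd ℝ (StateSpace d) ℝ).intervalIntegral_comp_comm
      (hw.intervalIntegrable_deriv 0 τ)
    rw [ContinuousLinearMap.coe_snd', hw.intervalIntegral_deriv_eq_sub', Prod.snd_sub] at h1
    have hle : ∀ᵐ r ∂(volume : Measure ℝ).restrict (Icc 0 τ),
        (L r.toNNReal (w r).1 (σ ((r, (w r).1), deriv w r)) : ℝ) ≤ (deriv w r).2 := by
      filter_upwards [ae_restrict_of_ae hmem, ae_restrict_mem measurableSet_Icc] with r hr hrt
      exact (hσ' _ (hr hrt.1)).2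
    rw [← h1, intervalIntegral.integral_of_le (NNReal.coe_nonneg τ),
      ← integral_Icc_eq_integral_Ioc, ofReal_integral_eq_lintegral_ofReal,
      setLIntegral_timeMeasure_Iic]
    · refine lintegral_mono_ae ?_
      filter_upwards [hle, ae_restrict_mem measurableSet_Icc] with r hr hrt
      rw [Real.coe_toNNReal r hrt.1, ← ENNReal.ofReal_coe_nnreal]
      exact ENNReal.ofReal_le_ofReal hr
    · have := (intervalIntegrable_iff_integrableOn_Icc_of_le (NNReal.coe_nonneg τ)).1
        (hw.intervalIntegrable_deriv 0 τ)
      exact (ContinuousLinearMap.snd ℝ (StateSpace d) ℝ).integrable_comp this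
    · filter_upwards [hle] with r hr
      exact le_trans (NNReal.coe_nonneg _) hr

end Optimal

/-! ### Borel selection of optimal trajectories, controls and arrival times. -/

theorem Measurable.uncurry_dite {X T β : Type*} [MeasurableSpace X] [MeasurableSpace T]
    [MeasurableSpace β] {S : Set X} [∀ x, Decidable (x ∈ S)] (hS : MeasurableSet S)
    {f : S → T → β} (hf : Measurable (Function.uncurry f)) (b : β) :
    Measurable (Function.uncurry fun (x : X) (t : T) => if h : x ∈ S then f ⟨x, h⟩ t else b) := by
  let _ : ∀ q : X × T, Decidable (q ∈ (Prod.fst ⁻¹' S : Set (X × T))) :=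
    fun q => inferInstanceAs (Decidable (q.1 ∈ S))
  have hmap : Measurable fun q : ↥(Prod.fst ⁻¹' S : Set (X × T)) =>
      ((⟨q.1.1, q.2⟩ : S), q.1.2) :=
    ((measurable_fst.comp measurable_subtype_coe).subtype_mk).prodMk
      (measurable_snd.comp measurable_subtype_coe)
  exact Measurable.dite (s := (Prod.fst ⁻¹' S : Set (X × T))) (hf.comp hmap)
    (measurable_const (a := b)) (measurable_fst hS)

/-- A Lipschitz curve together with an end time at most `T`. -/
abbrev TimedLipschitzCurves (E : Type*) [NormedAddCommGroup E] (M : ℝ≥0) (R T : ℝ) : Type _ :=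
  LipschitzCurves E M R × Icc (0 : ℝ) T

section Selection

variable {d : ℕ} {k : ℝ≥0 → StateSpace d → StateSpace d → StateSpace d}
  {L : ℝ≥0 → StateSpace d → StateSpace d → ℝ≥0} {U Ω : Set (StateSpace d)}

/-- Borel selection of cheapest relaxed solutions joining the points of `Ω`, among those which
arrive before a time `T`. -/
theorem exists_measurable_optimal_relaxedSolution
    (hk : Continuous fun q : ℝ≥0 × StateSpace d × StateSpace d => k q.1 q.2.1 q.2.2)
    (hL : Continuous fun q : ℝ≥0 × StateSpace d × StateSpace d => L q.1 q.2.1 q.2.2)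
    (hU : IsCompact U) {R : ℝ} (hR : ∀ x ∈ Ω, ‖x‖ ≤ R) {M : ℝ≥0} {T : ℝ}
    (hreach : ∀ x ∈ Ω, ∀ y ∈ Ω, ∃ w : ℝ → StateSpace d × ℝ, LipschitzWith M w ∧ w 0 = (x, 0) ∧
      IsRelaxedSolution (velocityCost k L) U w ∧ ∃ τ ∈ Icc 0 T, (w τ).1 = y) :
    ∃ (w : ↥(Ω ×ˢ Ω) → ℝ → StateSpace d × ℝ) (τ : ↥(Ω ×ˢ Ω) → ℝ),
      Measurable (Function.uncurry w) ∧
      Measurable (Function.uncurry fun p => deriv (w p)) ∧ Measurable τ ∧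
      ∀ p, LipschitzWith M (w p) ∧ w p 0 = (p.1.1, 0) ∧
        IsRelaxedSolution (velocityCost k L) U (w p) ∧ τ p ∈ Icc 0 T ∧ (w p (τ p)).1 = p.1.2 ∧
        ∀ w' : ℝ → StateSpace d × ℝ, LipschitzWith M w' → w' 0 = (p.1.1, 0) →
          IsRelaxedSolution (velocityCost k L) U w' → ∀ τ' ∈ Icc 0 T, (w' τ').1 = p.1.2 →
          (w p (τ p)).2 ≤ (w' τ').2 := by
  have hg := continuous_velocityCost hk hL
  let _ : MeasurableSpace (TimedLipschitzCurves (StateSpace d × ℝ) M R T) := borel _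
  have : BorelSpace (TimedLipschitzCurves (StateSpace d × ℝ) M R T) := ⟨rfl⟩
  let _ := TopologicalSpace.metrizableSpaceMetric
    (TimedLipschitzCurves (StateSpace d × ℝ) M R T)
  have hev : Continuous fun q : TimedLipschitzCurves (StateSpace d × ℝ) M R T × ℝ => q.1.1.1 q.2 :=
    LipschitzCurves.continuous_eval.comp
      (by fun_prop : Continuous fun q : TimedLipschitzCurves (StateSpace d × ℝ) M R T × ℝ => (q.1.1, q.2))
  have hend : Continuous fun q : TimedLipschitzCurves (StateSpace d × ℝ) M R T => q.1.1 q.2.1 :=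
    LipschitzCurves.continuous_eval.comp
      (by fun_prop : Continuous fun q : TimedLipschitzCurves (StateSpace d × ℝ) M R T => (q.1, q.2.1))
  have hstart : Continuous fun q : TimedLipschitzCurves (StateSpace d × ℝ) M R T => q.1.1 0 :=
    (continuous_apply (0 : ℝ)).comp (continuous_subtype_val.comp continuous_fst)
  let G : Set (↥(Ω ×ˢ Ω) × TimedLipschitzCurves (StateSpace d × ℝ) M R T) := {q | q.2.1.1 0 = (q.1.1.1, 0) ∧
    IsRelaxedSolution (velocityCost k L) U q.2.1.1 ∧ (q.2.1.1 q.2.2.1).1 = q.1.1.2}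
  have hG : IsClosed G := by
    refine IsClosed.inter (isClosed_eq (hstart.comp continuous_snd) (by fun_prop))
      (IsClosed.inter ?_ (isClosed_eq (hend.comp continuous_snd).fst (by fun_prop)))
    exact (isClosed_isRelaxedSolution hg hU).preimage
      (by fun_prop : Continuous fun q : ↥(Ω ×ˢ Ω) × TimedLipschitzCurves (StateSpace d × ℝ) M R T => q.2.1)
  obtain ⟨f, hf, hmin⟩ := exists_measurable_argmin hG (fun p => by
    obtain ⟨w, h1, h2, h3, τ, hτ, h4⟩ := hreach _ p.2.1 _ p.2.2
    exact ⟨(⟨w, h1, by simpa [h2] using hR _ p.2.1⟩, ⟨τ, hτ⟩), h2, h3, h4⟩) hend.snd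
  have hpair : Measurable fun q : ↥(Ω ×ˢ Ω) × ℝ => (f q.1, q.2) :=
    (hf.comp measurable_fst).prodMk measurable_snd
  refine ⟨fun p => (f p).1.1, fun p => (f p).2.1, hev.measurable.comp hpair,
    -- Joint continuity of evaluation makes the derivative jointly measurable in the curve and the
    -- time; the control is built from it.
    (measurable_deriv_with_param (f := fun (q : TimedLipschitzCurves (StateSpace d × ℝ) M R T) => q.1.1) hev).comp hpair,
    (continuous_subtype_val.comp continuous_snd : Continuous fun q : TimedLipschitzCurves (StateSpace d × ℝ) M R T => q.2.1).measurable.comp hf,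
    fun p => ⟨(f p).1.2.1, (hmin p).1.1, (hmin p).1.2.1, (f p).2.2, (hmin p).1.2.2, ?_⟩⟩
  intro w' h1 h2 h3 τ' hτ' h4
  exact (hmin p).2 (⟨w', h1, by simpa [h2] using hR _ p.2.1⟩, ⟨τ', hτ'⟩) ⟨h2, h3, h4⟩

/-- The cheapest relaxed solutions arriving before `T` are turned into controlled ones by `σ`. They
beat every admissible trajectory, since each of those either never arrives, arrives after `T`, or is
itself a relaxed competitor. -/
theorem exists_isBorelOptimalSelection
    (hk : Continuous fun q : ℝ≥0 × StateSpace d × StateSpace d => k q.1 q.2.1 q.2.2)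
    (hL : Continuous fun q : ℝ≥0 × StateSpace d × StateSpace d => L q.1 q.2.1 q.2.2)
    (hΩ : IsCompact Ω) (hU : IsCompact U)
    (hκ : ∃ κ : ℝ, ∀ t x, ∀ u ∈ U, ‖k t x u‖ ≤ κ)
    (hctrl : ∃ α : ℝ, 0 < α ∧ ∀ t x v, ∃ u ∈ U, inner ℝ (k t x u) v ≤ -α * ‖v‖)
    (hβ : ∃ β₁ β₂ : ℝ, 0 < β₂ ∧ ∀ t x, ∀ u ∈ U, β₂ ≤ (L t x u : ℝ) ∧ (L t x u : ℝ) ≤ β₁)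
    (hconv : ∀ t x, Convex ℝ
      {q : StateSpace d × ℝ | ∃ u ∈ U, k t x u = q.1 ∧ (L t x u : ℝ) ≤ q.2}) :
    ∃ (γ : StateSpace d × StateSpace d → ℝ≥0 → StateSpace d)
        (u : StateSpace d × StateSpace d → ℝ≥0 → U)
        (τ : StateSpace d × StateSpace d → ℝ≥0),
      IsBorelOptimalSelection k L U Ω γ u τ := by
  classical
  obtain ⟨κ, hκ⟩ := hκ
  obtain ⟨α, hα, hctrl⟩ := hctrl
  obtain ⟨β₁, β₂, hβ₂, hβ⟩ := hβ
  obtain ⟨R, hR⟩ := hΩ.isBounded.exists_norm_le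
  have hne : U.Nonempty := by
    obtain ⟨u, hu, -⟩ := hctrl 0 0 0
    exact ⟨u, hu⟩
  obtain ⟨u₀, hu₀⟩ := hne
  have hne : U.Nonempty := ⟨u₀, hu₀⟩
  have hg := continuous_velocityCost hk hL
  let M : ℝ≥0 := (max κ β₁).toNNReal
  have hM : ∀ t x, ∀ u ∈ U, ‖velocityCost k L t x u‖ ≤ M := by
    intro t x u hu
    refine le_trans ?_ (Real.le_coe_toNNReal _)
    refine max_le_max (hκ _ _ u hu) ?_
    rw [velocityCost, Real.norm_of_nonneg (NNReal.coe_nonneg _)]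
    exact (hβ _ _ u hu).2
  obtain ⟨σ, hσ, hσ'⟩ := exists_measurable_control hg hU hne
  -- All pairs in `Ω` can be joined within time `T₀`, at cost at most `M * T₀`. Arriving after `M *
  -- T₀ / β₂` costs at least as much, so the horizon `T` loses nothing.
  let T₀ : ℝ := 2 * (R + R) / α + α
  let T : ℝ := max T₀ (M * T₀ / β₂)
  have hreach : ∀ x ∈ Ω, ∀ y ∈ Ω, ∃ w : ℝ → StateSpace d × ℝ, LipschitzWith M w ∧
      w 0 = (x, 0) ∧ IsRelaxedSolution (velocityCost k L) U w ∧
      ∃ τ ∈ Icc 0 T₀, (w τ).1 = y := by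
    intro x hx y hy
    obtain ⟨w, h1, h2, h3, τ, hτ, h4⟩ := exists_isRelaxedSolution_reaching hg hU hM hα
      (fun t z v => hctrl t.toNNReal z v) x y
    refine ⟨w, h1, h2, h3, τ, ⟨hτ.1, hτ.2.trans ?_⟩, h4⟩
    have : ‖x - y‖ ≤ R + R := (norm_sub_le x y).trans (add_le_add (hR x hx) (hR y hy))
    simp only [T₀]
    gcongr
  obtain ⟨w, τ, hwm, hdm, hτm, hopt⟩ := exists_measurable_optimal_relaxedSolution (M := M) (T := T)
    hk hL hU hR (fun x hx y hy => by
      obtain ⟨w, h1, h2, h3, τ, hτ, h4⟩ := hreach x hx y hy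
      exact ⟨w, h1, h2, h3, τ, ⟨hτ.1, hτ.2.trans (le_max_left _ _)⟩, h4⟩)
  have hconv' : ∀ t x, Convex ℝ
      {q : StateSpace d × ℝ | ((t, x), q) ∈ velocityEpigraph (velocityCost k L) U} :=
    fun t x => hconv t.toNNReal x
  have hΩm : MeasurableSet (Ω ×ˢ Ω) := hΩ.measurableSet.prod hΩ.measurableSet
  let v : ↥(Ω ×ˢ Ω) → ℝ≥0 → U := fun p t => σ ((t, (w p t).1), deriv (w p) t)
  have hadm : ∀ p : ↥(Ω ×ˢ Ω), IsAdmissibleTrajectory k U p.1.1 (v p) (fun t => (w p t).1) ∧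
      ∀ s : ℝ≥0, ∫⁻ r in Iic s, (L r (w p r).1 (v p r) : ℝ≥0∞) ∂timeMeasure
        ≤ ENNReal.ofReal (w p s).2 := by
    intro p
    obtain ⟨h1, h2, h3, -⟩ := hopt p
    have := h3.isAdmissibleTrajectory hk hL hU hne hconv' hσ hσ' h1
    simp only [h2, sub_zero] at this
    exact this
  -- The selected end time is a first arrival: stopping at an earlier passage through the target
  -- would be strictly cheaper, as the cost grows at rate at least `β₂`.
  have hhit : ∀ p : ↥(Ω ×ˢ Ω), hittingTimeOf (fun t : ℝ≥0 => (w p t).1) p.1.2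
      = ((τ p).toNNReal : ℝ≥0∞) := by
    intro p
    obtain ⟨h1, h2, h3, h4, h5, h6⟩ := hopt p
    have hτ0 : (w p ((τ p).toNNReal : ℝ)).1 = p.1.2 := by rwa [Real.coe_toNNReal _ h4.1]
    refine le_antisymm (hittingTimeOf_le hτ0) (le_iInf₂ fun s hs => ENNReal.coe_le_coe.2 ?_)
    by_contra! hlt
    have hlt' : (s : ℝ) < τ p := Real.lt_toNNReal_iff_coe_lt.1 hlt
    have h7 := h6 (w p) h1 h2 h3 (s : ℝ) ⟨NNReal.coe_nonneg s, hlt'.le.trans h4.2⟩ hs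
    have h8 := h3.le_snd_sub hg hU hne h1.continuous (β := β₂)
      (fun t x u hu => (hβ t.toNNReal x u hu).1) (NNReal.coe_nonneg s) hlt'.le
    have : 0 < β₂ * (τ p - s) := mul_pos hβ₂ (sub_pos.2 hlt')
    linarith
  have hminimal : ∀ (p : ↥(Ω ×ˢ Ω)) (u' : ℝ≥0 → U) (γ' : ℝ≥0 → StateSpace d),
      IsAdmissibleTrajectory k U p.1.1 u' γ' →
      runningCost L (v p) (fun t => (w p t).1) p.1.2 ≤ runningCost L u' γ' p.1.2 := by
    intro p u' γ' hadm'
    obtain ⟨h1, h2, h3, h4, h5, h6⟩ := hopt p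
    by_cases hex : ∃ s, γ' s = p.1.2
    · obtain ⟨τ', hτ', hy⟩ := exists_hittingTimeOf_eq hadm'.continuous hex
      obtain ⟨w', g1, g2, g3, g4⟩ := hadm'.exists_isRelaxedSolution hk hL hU hM
      rw [runningCost_eq_setLIntegral_Iic L _ _ (hhit p),
        runningCost_eq_setLIntegral_Iic L _ _ hτ', ← (g4 τ').2]
      refine ((hadm p).2 _).trans (ENNReal.ofReal_le_ofReal ?_)
      rw [Real.coe_toNNReal _ h4.1]
      rcases le_total (τ' : ℝ) T with hle | hle
      · exact h6 w' g1 g2 g3 τ' ⟨NNReal.coe_nonneg τ', hle⟩ ((g4 τ').1.trans hy)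
      · obtain ⟨w₁, e1, e2, e3, τ₁, e4, e5⟩ := hreach _ p.2.1 _ p.2.2
        have h7 := h6 w₁ e1 e2 e3 τ₁ ⟨e4.1, e4.2.trans (le_max_left _ _)⟩ e5
        have h8 : (w₁ τ₁).2 ≤ M * T₀ := by
          have h := e1.dist_le_mul τ₁ 0
          rw [dist_eq_norm, Real.dist_eq, sub_zero, abs_of_nonneg e4.1] at h
          have h' := (le_abs_self _).trans ((norm_snd_le _).trans h)
          rw [Prod.snd_sub, e2, sub_zero] at h'
          exact h'.trans (mul_le_mul_of_nonneg_left e4.2 M.2)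
        have h9 := g3.le_snd_sub hg hU hne g1.continuous (β := β₂)
          (fun t x u hu => (hβ t.toNNReal x u hu).1) le_rfl (NNReal.coe_nonneg τ')
        rw [g2, sub_zero, sub_zero] at h9
        have h10 : M * T₀ ≤ β₂ * τ' := by
          have := (le_max_right T₀ (M * T₀ / β₂)).trans hle
          rwa [div_le_iff₀' hβ₂] at this
        linarith
    · rw [runningCost_eq_top L (β := β₂.toNNReal) (Real.toNNReal_pos.2 hβ₂)
        (fun t x u hu => Real.toNNReal_le_iff_le_coe.2 (hβ t x u hu).1) u' γ' hex]
      exact le_top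
  refine ⟨fun p t => if h : p ∈ Ω ×ˢ Ω then (w ⟨p, h⟩ t).1 else 0,
    fun p t => if h : p ∈ Ω ×ˢ Ω then v ⟨p, h⟩ t else ⟨u₀, hu₀⟩,
    fun p => if h : p ∈ Ω ×ˢ Ω then (τ ⟨p, h⟩).toNNReal else 0, ?_, ?_, ?_, ?_, ?_⟩
  · exact Measurable.uncurry_dite hΩm (f := fun p (t : ℝ≥0) => (w p t).1)
      (measurable_fst.comp (hwm.comp (measurable_fst.prodMk
        (measurable_coe_nnreal_real.comp measurable_snd)))) 0
  · have hcoe : Measurable fun q : ↥(Ω ×ˢ Ω) × ℝ≥0 => (q.1, (q.2 : ℝ)) :=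
      measurable_fst.prodMk (measurable_coe_nnreal_real.comp measurable_snd)
    refine Measurable.uncurry_dite hΩm (f := v) (hσ.comp ?_) ⟨u₀, hu₀⟩
    exact ((measurable_snd.comp hcoe).prodMk (measurable_fst.comp (hwm.comp hcoe))).prodMk
      (hdm.comp hcoe)
  · exact Measurable.dite (measurable_real_toNNReal.comp hτm) measurable_const hΩm
  · intro x hx y hy
    have hp : (x, y) ∈ Ω ×ˢ Ω := ⟨hx, hy⟩
    simp only [dif_pos hp]
    exact ⟨(hadm ⟨(x, y), hp⟩).1, hminimal ⟨(x, y), hp⟩⟩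
  · intro x hx y hy
    have hp : (x, y) ∈ Ω ×ˢ Ω := ⟨hx, hy⟩
    simp only [dif_pos hp]
    exact (hhit ⟨(x, y), hp⟩).symm

end Selection

/-! ### The Eulerian pair carried by a plan. -/

section Eulerian

variable {d : ℕ} {k : ℝ≥0 → StateSpace d → StateSpace d → StateSpace d}
  {L : ℝ≥0 → StateSpace d → StateSpace d → ℝ≥0} {U Ω : Set (StateSpace d)}
  {γ : StateSpace d × StateSpace d → ℝ≥0 → StateSpace d}
  {u : StateSpace d × StateSpace d → ℝ≥0 → U} {τ : StateSpace d × StateSpace d → ℝ≥0}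
  {π : Measure (StateSpace d × StateSpace d)}

/-- Extending the trajectory to all real times makes the integral equation a differential one almost
everywhere, by Lebesgue differentiation. -/
theorem IsAdmissibleTrajectory.exists_lipschitzWith
    (hk : Continuous fun q : ℝ≥0 × StateSpace d × StateSpace d => k q.1 q.2.1 q.2.2)
    {M : ℝ≥0} (hM : ∀ t x, ∀ u ∈ U, ‖k t x u‖ ≤ M)
    {x : StateSpace d} {u : ℝ≥0 → U} {γ : ℝ≥0 → StateSpace d}
    (h : IsAdmissibleTrajectory k U x u γ) :
    ∃ w : ℝ → StateSpace d, LipschitzWith M w ∧ (∀ t : ℝ≥0, w t = γ t) ∧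
      ∀ᵐ t : ℝ, HasDerivAt w (k t.toNNReal (γ t.toNNReal) (u t.toNNReal)) t := by
  let c : ℝ → StateSpace d := fun r => k r.toNNReal (γ r.toNNReal) (u r.toNNReal)
  have hcM : ∀ r, ‖c r‖ ≤ M := fun r => hM _ _ _ (u r.toNNReal).2
  have hcm : Measurable c := hk.measurable.comp (measurable_real_toNNReal.prodMk
    ((h.continuous.measurable.comp measurable_real_toNNReal).prodMk
      (measurable_subtype_coe.comp (h.measurable_control.comp measurable_real_toNNReal))))
  have hloc : LocallyIntegrable c volume :=
    (locallyIntegrable_const (M : ℝ)).mono hcm.aestronglyMeasurable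
      (Filter.Eventually.of_forall fun r => (hcM r).trans (le_abs_self _))
  have hci : ∀ s t, IntervalIntegrable c volume s t := fun s t => by
    have hi : IntervalIntegrable (fun _ : ℝ => (M : ℝ)) volume s t := intervalIntegrable_const
    exact hi.mono_fun hcm.aestronglyMeasurable
      (Filter.Eventually.of_forall fun r => (hcM r).trans (le_abs_self _))
  refine ⟨fun t => x + ∫ r in (0 : ℝ)..t, c r, LipschitzWith.of_dist_le_mul fun s t => ?_,
    fun t => ?_, ?_⟩
  · rw [dist_eq_norm, add_sub_add_left_eq_sub,
      intervalIntegral.integral_interval_sub_left (hci _ _) (hci _ _), Real.dist_eq]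
    exact intervalIntegral.norm_integral_le_of_norm_le_const fun r _ => hcM r
  · rw [h.integral_eq t, setIntegral_timeMeasure_Iic]
  · filter_upwards [LocallyIntegrable.ae_hasDerivAt_integral hloc] with t ht
    exact (ht 0).const_add x

/-- The fundamental theorem of calculus for a test function along an admissible trajectory. -/
theorem IsAdmissibleTrajectory.setIntegral_fderiv
    (hk : Continuous fun q : ℝ≥0 × StateSpace d × StateSpace d => k q.1 q.2.1 q.2.2)
    {M : ℝ≥0} (hM : ∀ t x, ∀ u ∈ U, ‖k t x u‖ ≤ M)
    {x : StateSpace d} {u : ℝ≥0 → U} {γ : ℝ≥0 → StateSpace d}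
    (h : IsAdmissibleTrajectory k U x u γ) {ξ : ℝ × StateSpace d → ℝ} (hξ : ContDiff ℝ 1 ξ)
    (hsupp : HasCompactSupport ξ) (T : ℝ≥0) :
    ∫ t in Iic T, fderiv ℝ ξ ((t : ℝ), γ t) (1, k t (γ t) (u t)) ∂timeMeasure
      = ξ (T, γ T) - ξ (0, γ 0) := by
  obtain ⟨w, hw, hwγ, hd⟩ := h.exists_lipschitzWith hk hM
  obtain ⟨C, hC⟩ := hξ.lipschitzWith_of_hasCompactSupport hsupp one_ne_zero
  have hlip := (hC.comp (LipschitzWith.id.prodMk hw)).intervalIntegral_deriv_eq_sub 0 T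
  simp only [Function.comp_apply, id] at hlip
  rw [hwγ T] at hlip
  have h0 : w 0 = γ 0 := by simpa using hwγ 0
  rw [h0] at hlip
  rw [← hlip, setIntegral_timeMeasure_Iic]
  refine intervalIntegral.integral_congr_ae ?_
  filter_upwards [hd] with t ht htmem
  rw [uIoc_of_le (NNReal.coe_nonneg T)] at htmem
  have hcoe := Real.coe_toNNReal t htmem.1.le
  have hwt := hwγ t.toNNReal
  rw [hcoe] at hwt
  rw [hcoe, ← hwt]
  rw [← hwt] at ht
  exact (((hξ.differentiable one_ne_zero).differentiableAt.hasFDerivAt.comp_hasDerivAt t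
    ((hasDerivAt_id t).prodMk ht)).deriv).symm

theorem measurable_planDensity [IsFiniteMeasure π] (hγ : Measurable (Function.uncurry γ))
    (hu : Measurable (Function.uncurry u)) (hτ : Measurable τ) :
    Measurable (planDensity γ u τ π) := by
  refine Measure.measurable_of_measurable_coe _ fun s hs => ?_
  have hle : MeasurableSet {q : ℝ≥0 × (StateSpace d × StateSpace d) | q.1 ≤ τ q.2} :=
    measurableSet_le measurable_fst (hτ.comp measurable_snd)
  have hA : MeasurableSet {q : ℝ≥0 × (StateSpace d × StateSpace d) |
      (γ q.2 q.1, u q.2 q.1) ∈ s ∧ q.1 ≤ τ q.2} :=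
    (((hγ.comp measurable_swap).prodMk (hu.comp measurable_swap)) hs).inter hle
  convert measurable_measure_prodMk_left (ν := π) hA using 2 with t
  have hm : Measurable fun p => (γ p t, u p t) :=
    (hγ.comp measurable_prodMk_right).prodMk (hu.comp measurable_prodMk_right)
  rw [planDensity, Measure.map_apply hm hs, Measure.restrict_apply (hm hs)]
  rfl

theorem lintegral_planDensity [IsFiniteMeasure π] (hγ : Measurable (Function.uncurry γ))
    (hu : Measurable (Function.uncurry u)) (hτ : Measurable τ)
    {F : ℝ≥0 → StateSpace d × U → ℝ≥0∞} (hF : Measurable (Function.uncurry F)) :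
    ∫⁻ t, ∫⁻ q, F t q ∂(planDensity γ u τ π t) ∂timeMeasure
      = ∫⁻ p, ∫⁻ t in Iic (τ p), F t (γ p t, u p t) ∂timeMeasure ∂π := by
  have hmap : Measurable fun q : ℝ≥0 × (StateSpace d × StateSpace d) =>
      (q.1, (γ q.2 q.1, u q.2 q.1)) :=
    measurable_fst.prodMk ((hγ.comp measurable_swap).prodMk (hu.comp measurable_swap))
  have hA : MeasurableSet {q : ℝ≥0 × (StateSpace d × StateSpace d) | q.1 ≤ τ q.2} :=
    measurableSet_le measurable_fst (hτ.comp measurable_snd)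
  have hG := ((hF.comp hmap).indicator hA).aemeasurable (μ := timeMeasure.prod π)
  calc ∫⁻ t, ∫⁻ q, F t q ∂(planDensity γ u τ π t) ∂timeMeasure
      = ∫⁻ t, ∫⁻ p, {q : ℝ≥0 × (StateSpace d × StateSpace d) | q.1 ≤ τ q.2}.indicator
          (Function.uncurry F ∘ fun q => (q.1, (γ q.2 q.1, u q.2 q.1))) (t, p) ∂π
          ∂timeMeasure := by
        refine lintegral_congr fun t => ?_
        have hm : Measurable fun p => (γ p t, u p t) :=
          (hγ.comp measurable_prodMk_right).prodMk (hu.comp measurable_prodMk_right)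
        have hFt : Measurable fun q => F t q := hF.comp measurable_prodMk_left
        rw [planDensity, lintegral_map hFt hm,
          ← lintegral_indicator (measurableSet_le measurable_const hτ)]
        rfl
    _ = ∫⁻ p, ∫⁻ t, {q : ℝ≥0 × (StateSpace d × StateSpace d) | q.1 ≤ τ q.2}.indicator
          (Function.uncurry F ∘ fun q => (q.1, (γ q.2 q.1, u q.2 q.1))) (t, p) ∂timeMeasure
          ∂π := lintegral_lintegral_swap hG
    _ = _ := by
        refine lintegral_congr fun p => ?_
        rw [← lintegral_indicator measurableSet_Iic]
        rfl

/-- The integrand is bounded and vanishes after `T`, and `π` is finite, so Fubini applies even if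
the arrival times are unbounded. -/
theorem integral_planDensity [IsFiniteMeasure π] (hγ : Measurable (Function.uncurry γ))
    (hu : Measurable (Function.uncurry u)) (hτ : Measurable τ)
    {F : ℝ≥0 → StateSpace d × U → ℝ} (hF : Measurable (Function.uncurry F))
    {C : ℝ} (hC : ∀ t q, |F t q| ≤ C) {T : ℝ≥0} (hT : ∀ t q, T < t → F t q = 0) :
    ∫ t, ∫ q, F t q ∂(planDensity γ u τ π t) ∂timeMeasure
      = ∫ p, ∫ t in Iic (τ p), F t (γ p t, u p t) ∂timeMeasure ∂π := by
  have hmap : Measurable fun q : ℝ≥0 × (StateSpace d × StateSpace d) =>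
      (q.1, (γ q.2 q.1, u q.2 q.1)) :=
    measurable_fst.prodMk ((hγ.comp measurable_swap).prodMk (hu.comp measurable_swap))
  have hA : MeasurableSet {q : ℝ≥0 × (StateSpace d × StateSpace d) | q.1 ≤ τ q.2} :=
    measurableSet_le measurable_fst (hτ.comp measurable_snd)
  have hbound : Integrable (fun q : ℝ≥0 × (StateSpace d × StateSpace d) =>
      (Iic T).indicator (fun _ => C) q.1) (timeMeasure.prod π) := by
    refine Integrable.comp_fst (f := (Iic T).indicator fun _ => C) ?_ π
    refine (integrable_indicator_iff measurableSet_Iic).2 (integrableOn_const ?_)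
    rw [timeMeasure_Iic]
    exact ENNReal.coe_ne_top
  have hG : Integrable (fun q : ℝ≥0 × (StateSpace d × StateSpace d) =>
      {q : ℝ≥0 × (StateSpace d × StateSpace d) | q.1 ≤ τ q.2}.indicator
        (Function.uncurry F ∘ fun q => (q.1, (γ q.2 q.1, u q.2 q.1))) q)
      (timeMeasure.prod π) := by
    refine hbound.mono' ((hF.comp hmap).indicator hA).aestronglyMeasurable
      (Filter.Eventually.of_forall fun q => ?_)
    refine (norm_indicator_le_norm_self _ _).trans ?_
    by_cases hq : q.1 ∈ Iic T
    · rw [indicator_of_mem hq]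
      exact hC _ _
    · rw [indicator_of_notMem hq]
      simp [hT q.1 _ (not_le.1 hq)]
  calc ∫ t, ∫ q, F t q ∂(planDensity γ u τ π t) ∂timeMeasure
      = ∫ t, ∫ p, {q : ℝ≥0 × (StateSpace d × StateSpace d) | q.1 ≤ τ q.2}.indicator
          (Function.uncurry F ∘ fun q => (q.1, (γ q.2 q.1, u q.2 q.1))) (t, p) ∂π
          ∂timeMeasure := by
        refine integral_congr_ae (Filter.Eventually.of_forall fun t => ?_)
        have hm : Measurable fun p => (γ p t, u p t) :=
          (hγ.comp measurable_prodMk_right).prodMk (hu.comp measurable_prodMk_right)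
        have hFt : Measurable fun q => F t q := hF.comp measurable_prodMk_left
        simp only
        rw [planDensity, integral_map hm.aemeasurable hFt.aestronglyMeasurable,
          ← integral_indicator (measurableSet_le measurable_const hτ)]
        rfl
    _ = ∫ p, ∫ t, {q : ℝ≥0 × (StateSpace d × StateSpace d) | q.1 ≤ τ q.2}.indicator
          (Function.uncurry F ∘ fun q => (q.1, (γ q.2 q.1, u q.2 q.1))) (t, p) ∂timeMeasure
          ∂π := integral_integral_swap hG
    _ = _ := by
        refine integral_congr_ae (Filter.Eventually.of_forall fun p => ?_)
        simp only
        rw [← integral_indicator measurableSet_Iic]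
        rfl

theorem MeasureTheory.Measure.restrict_interior_add_restrict_frontier {X : Type*}
    [TopologicalSpace X] [MeasurableSpace X] [OpensMeasurableSpace X] {S : Set X}
    (hS : IsClosed S) {μ : Measure X} (hμ : μ Sᶜ = 0) :
    μ.restrict (interior S) + μ.restrict (frontier S) = μ := by
  rw [← Measure.restrict_union disjoint_interior_frontier isClosed_frontier.measurableSet,
    ← closure_eq_interior_union_frontier, hS.closure_eq]
  exact Measure.restrict_eq_self_of_ae_mem hμ

theorem planDensity_zero_fst (h : IsBorelOptimalSelection k L U Ω γ u τ)
    (hπ : π (Ω ×ˢ Ω)ᶜ = 0) : (planDensity γ u τ π 0).fst = π.fst := by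
  have hm : Measurable fun p => (γ p 0, u p 0) :=
    (h.measurable_trajectory.comp measurable_prodMk_right).prodMk
      (h.measurable_control.comp measurable_prodMk_right)
  rw [planDensity, Measure.fst, Measure.map_map measurable_fst hm]
  -- The non-strict condition `t ≤ τ` matters here: at `t = 0` it retains all of `π`, including
  -- pairs with zero arrival time.
  simp only [zero_le, ofPred_true, Measure.restrict_univ]
  refine Measure.map_congr ?_
  have hae : ∀ᵐ p ∂π, p ∈ Ω ×ˢ Ω := hπ
  filter_upwards [hae] with p hp
  have := (h.optimal _ hp.1 _ hp.2).admissible.integral_eq 0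
  rw [setIntegral_timeMeasure_Iic] at this
  simpa using this

theorem planStopping_snd (hτ : Measurable τ) : (planStopping τ π).snd = π.snd := by
  rw [planStopping, Measure.snd, Measure.map_map measurable_snd (hτ.prodMk measurable_snd)]
  rfl

theorem IsBorelOptimalSelection.apply_endTime (h : IsBorelOptimalSelection k L U Ω γ u τ)
    {x y : StateSpace d} (hx : x ∈ Ω) (hy : y ∈ Ω) : γ (x, y) (τ (x, y)) = y := by
  have hend := h.endTime_eq x hx y hy
  have hex : ∃ s, γ (x, y) s = y := by
    by_contra hnot
    have : hittingTimeOf (γ (x, y)) y = ⊤ := iInf₂_eq_top.2 fun s hs => (hnot ⟨s, hs⟩).elim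
    rw [this] at hend
    exact ENNReal.coe_ne_top hend
  obtain ⟨s, hs, hsy⟩ := exists_hittingTimeOf_eq (h.optimal x hx y hy).admissible.continuous hex
  rw [← hend, ENNReal.coe_inj] at hs
  rwa [hs]

theorem IsBorelOptimalSelection.transportCost_eq (h : IsBorelOptimalSelection k L U Ω γ u τ)
    {x y : StateSpace d} (hx : x ∈ Ω) (hy : y ∈ Ω) :
    transportCost k L U x y = ∫⁻ t in Iic (τ (x, y)),
      (L t (γ (x, y) t) (u (x, y) t) : ℝ≥0∞) ∂timeMeasure := by
  rw [← runningCost_eq_setLIntegral_Iic L _ _ (h.endTime_eq x hx y hy).symm]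
  have hopt := h.optimal x hx y hy
  refine le_antisymm (iInf_le_of_le _ (iInf₂_le _ hopt.admissible)) ?_
  exact le_iInf fun u' => le_iInf₂ fun γ' hadm => hopt.minimal u' γ' hadm

/-- By Fubini the weak equation is a `π`-average over trajectories, and along each one the
fundamental theorem of calculus leaves `ξ (τ, y) - ξ (0, x)`. -/
theorem planDensity_isEulerianPair
    (hk : Continuous fun q : ℝ≥0 × StateSpace d × StateSpace d => k q.1 q.2.1 q.2.2)
    (hκ : ∃ κ : ℝ, ∀ t x, ∀ u ∈ U, ‖k t x u‖ ≤ κ) [IsFiniteMeasure π]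
    (hπ : π (Ω ×ˢ Ω)ᶜ = 0) (h : IsBorelOptimalSelection k L U Ω γ u τ) :
    IsEulerianPair k U π.fst π.snd (planDensity γ u τ π) (planStopping τ π) := by
  have hγ := h.measurable_trajectory
  have hu := h.measurable_control
  have hτ := h.measurable_endTime
  have hfin : ∀ t, planDensity γ u τ π t univ ≤ π univ := fun t => by
    have hm : Measurable fun p => (γ p t, u p t) :=
      (hγ.comp measurable_prodMk_right).prodMk (hu.comp measurable_prodMk_right)
    rw [planDensity, Measure.map_apply hm .univ]
    exact Measure.restrict_apply_le _ _
  refine ⟨measurable_planDensity hγ hu hτ,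
    fun t => ⟨(hfin t).trans_lt (measure_lt_top π univ)⟩, fun T => ?_, ?_,
    planDensity_zero_fst h hπ, planStopping_snd hτ, fun ξ hξ hsupp => ?_⟩
  · calc ∫⁻ t in Iic T, planDensity γ u τ π t univ ∂timeMeasure
        ≤ ∫⁻ _ in Iic T, π univ ∂timeMeasure := lintegral_mono fun t => hfin t
      _ = π univ * T := by rw [setLIntegral_const, timeMeasure_Iic]
      _ < ∞ := ENNReal.mul_lt_top (measure_lt_top π univ) ENNReal.coe_lt_top
  · exact Measure.isFiniteMeasure_map π _
  · obtain ⟨κ, hκ⟩ := hκ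
    have hκ' : ∀ t x, ∀ u ∈ U, ‖k t x u‖ ≤ (κ.toNNReal : ℝ) :=
      fun t x u hu => (hκ t x u hu).trans (Real.le_coe_toNNReal κ)
    have hdc := hξ.continuous_fderiv one_ne_zero
    obtain ⟨C, hC⟩ := (hsupp.fderiv (𝕜 := ℝ)).exists_bound_of_continuous hdc
    obtain ⟨T, hT⟩ := (hsupp.fderiv (𝕜 := ℝ)).isCompact.isBounded.exists_norm_le
    let F : ℝ≥0 → StateSpace d × U → ℝ :=
      fun t q => fderiv ℝ ξ ((t : ℝ), q.1) (1, k t q.1 q.2)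
    have hFc : Continuous (Function.uncurry F) := by
      have h1 : Continuous fun q : ℝ≥0 × (StateSpace d × U) => fderiv ℝ ξ ((q.1 : ℝ), q.2.1) :=
        hdc.comp ((NNReal.continuous_coe.comp continuous_fst).prodMk (by fun_prop))
      have h2 : Continuous fun q : ℝ≥0 × (StateSpace d × U) =>
          ((1 : ℝ), k q.1 q.2.1 q.2.2) :=
        continuous_const.prodMk (hk.comp (by fun_prop :
          Continuous fun q : ℝ≥0 × (StateSpace d × U) => (q.1, q.2.1, (q.2.2 : StateSpace d))))
      exact h1.clm_apply h2
    have hFC : ∀ t q, |F t q| ≤ C * max 1 κ := by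
      intro t q
      refine ((fderiv ℝ ξ ((t : ℝ), q.1)).le_opNorm _).trans ?_
      refine mul_le_mul (hC _) (max_le_max (by simp) (hκ _ _ _ q.2.2)) (norm_nonneg _)
        ((norm_nonneg _).trans (hC 0))
    have hFT : ∀ t q, T.toNNReal < t → F t q = 0 := by
      intro t q ht
      have : fderiv ℝ ξ ((t : ℝ), q.1) = 0 := by
        refine image_eq_zero_of_notMem_tsupport fun hmem => ?_
        have h1 := (norm_fst_le ((t : ℝ), q.1)).trans (hT _ hmem)
        have h2 := (le_abs_self _).trans h1
        exact absurd ((Real.le_coe_toNNReal T).trans_lt (NNReal.coe_lt_coe.2 ht)) (not_lt.2 h2)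
      simp [F, this]
    have hmeas := hFc.measurable
    have hξi : ∀ (ν : Measure (StateSpace d × StateSpace d)) [IsFiniteMeasure ν]
        (f : StateSpace d × StateSpace d → ℝ × StateSpace d), Measurable f →
        Integrable (fun p => ξ (f p)) ν := by
      intro ν _ f hf
      obtain ⟨B, hB⟩ := hsupp.exists_bound_of_continuous hξ.continuous
      exact (integrable_const B).mono' (hξ.continuous.measurable.comp hf).aestronglyMeasurable
        (Filter.Eventually.of_forall fun p => hB _)
    have hcoe : Measurable fun p => (τ p : ℝ) := measurable_coe_nnreal_real.comp hτ
    calc ∫ t, ∫ q, F t q ∂(planDensity γ u τ π t) ∂timeMeasure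
        = ∫ p, ∫ t in Iic (τ p), F t (γ p t, u p t) ∂timeMeasure ∂π :=
          integral_planDensity hγ hu hτ hmeas hFC hFT
      _ = ∫ p, (ξ (τ p, p.2) - ξ (0, p.1)) ∂π := by
          refine integral_congr_ae ?_
          have hae : ∀ᵐ p ∂π, p ∈ Ω ×ˢ Ω := hπ
          filter_upwards [hae] with p hp
          have hadm := (h.optimal _ hp.1 _ hp.2).admissible
          have h0 := hadm.integral_eq 0
          rw [setIntegral_timeMeasure_Iic] at h0
          have h1 := hadm.setIntegral_fderiv hk hκ' hξ hsupp (τ p)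
          rw [h.apply_endTime hp.1 hp.2, h0] at h1
          simpa using h1
      _ = ∫ p, ξ (τ p, p.2) ∂π - ∫ p, ξ (0, p.1) ∂π :=
          integral_sub (hξi π _ (hcoe.prodMk measurable_snd))
            (hξi π _ (measurable_const.prodMk measurable_fst))
      _ = _ := by
          have h1 : Measurable fun q : ℝ≥0 × StateSpace d => ξ ((q.1 : ℝ), q.2) :=
            hξ.continuous.measurable.comp
              ((measurable_coe_nnreal_real.comp measurable_fst).prodMk measurable_snd)
          have h2 : Measurable fun x : StateSpace d => ξ (0, x) :=
            hξ.continuous.measurable.comp (measurable_const.prodMk measurable_id)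
          rw [planStopping, integral_map (hτ.prodMk measurable_snd).aemeasurable
            h1.aestronglyMeasurable, Measure.fst,
            integral_map measurable_fst.aemeasurable h2.aestronglyMeasurable]

theorem planDensity_mem_admissibleEulerianPairs
    (hk : Continuous fun q : ℝ≥0 × StateSpace d × StateSpace d => k q.1 q.2.1 q.2.2)
    (hΩ : IsCompact Ω) (hκ : ∃ κ : ℝ, ∀ t x, ∀ u ∈ U, ‖k t x u‖ ≤ κ)
    {μp μm : Measure (StateSpace d)} (hπ : π ∈ admissiblePlans Ω μp μm)
    (h : IsBorelOptimalSelection k L U Ω γ u τ) :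
    (planDensity γ u τ π, planStopping τ π) ∈ admissibleEulerianPairs k U Ω μp μm := by
  obtain ⟨hfin, hπΩ, hp, hm⟩ := hπ
  have hfst : π.fst Ωᶜ = 0 := by
    rw [Measure.fst_apply hΩ.measurableSet.compl]
    exact measure_mono_null (show Prod.fst ⁻¹' Ωᶜ ⊆ (Ω ×ˢ Ω)ᶜ from fun p hp hp' => hp hp'.1) hπΩ
  have hsnd : π.snd Ωᶜ = 0 := by
    rw [Measure.snd_apply hΩ.measurableSet.compl]
    exact measure_mono_null (show Prod.snd ⁻¹' Ωᶜ ⊆ (Ω ×ˢ Ω)ᶜ from fun p hp hp' => hp hp'.2) hπΩ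
  have hF : MeasurableSet (frontier Ω) := isClosed_frontier.measurableSet
  -- The imported and exported masses are the boundary parts of the marginals; the interior parts
  -- are prescribed.
  refine ⟨π.fst.restrict (frontier Ω), π.snd.restrict (frontier Ω), inferInstance, inferInstance,
    ?_, ?_, ?_⟩
  · rw [Measure.restrict_apply hF.compl, compl_inter_self, measure_empty]
  · rw [Measure.restrict_apply hF.compl, compl_inter_self, measure_empty]
  · rw [← hp, ← hm, Measure.restrict_interior_add_restrict_frontier hΩ.isClosed hfst,
      Measure.restrict_interior_add_restrict_frontier hΩ.isClosed hsnd]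
    exact planDensity_isEulerianPair hk hκ hπΩ h

theorem eulerianCost_plan_eq
    (hL : Continuous fun q : ℝ≥0 × StateSpace d × StateSpace d => L q.1 q.2.1 q.2.2)
    {ψp ψm : StateSpace d → ℝ} (hψp : ContinuousOn ψp (frontier Ω))
    (hψm : ContinuousOn ψm (frontier Ω)) [IsFiniteMeasure π] (hπ : π (Ω ×ˢ Ω)ᶜ = 0)
    (h : IsBorelOptimalSelection k L U Ω γ u τ) :
    eulerianCost L Ω ψp ψm (planDensity γ u τ π) (planStopping τ π)
      = kantorovichCost k L U Ω ψp ψm π := by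
  have hF : MeasurableSet (frontier Ω) := isClosed_frontier.measurableSet
  have hrun : ∫⁻ t : ℝ≥0, (∫⁻ p, (L t p.1 p.2 : ℝ≥0∞) ∂(planDensity γ u τ π t)) ∂timeMeasure
      = ∫⁻ p, transportCost k L U p.1 p.2 ∂π := by
    rw [lintegral_planDensity h.measurable_trajectory h.measurable_control h.measurable_endTime
      (F := fun t q => (L t q.1 q.2 : ℝ≥0∞)) ?_]
    · refine lintegral_congr_ae ?_
      have hae : ∀ᵐ p ∂π, p ∈ Ω ×ˢ Ω := hπ
      filter_upwards [hae] with p hp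
      exact (h.transportCost_eq hp.1 hp.2).symm
    · exact (ENNReal.continuous_coe.comp (hL.comp (by fun_prop :
        Continuous fun q : ℝ≥0 × (StateSpace d × U) =>
          (q.1, q.2.1, (q.2.2 : StateSpace d))))).measurable
  have hp : ∫ p in frontier Ω ×ˢ univ, ψp p.1 ∂(planDensity γ u τ π 0)
      = ∫ x in frontier Ω, ψp x ∂π.fst := by
    rw [← planDensity_zero_fst h hπ, prod_univ, Measure.fst,
      Measure.restrict_map measurable_fst hF, integral_map measurable_fst.aemeasurable]
    rw [← Measure.restrict_map measurable_fst hF]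
    exact hψp.aestronglyMeasurable hF
  have hm : ∫ q in univ ×ˢ frontier Ω, ψm q.2 ∂(planStopping τ π)
      = ∫ y in frontier Ω, ψm y ∂π.snd := by
    rw [← planStopping_snd h.measurable_endTime, univ_prod, Measure.snd,
      Measure.restrict_map measurable_snd hF, integral_map measurable_snd.aemeasurable]
    rw [← Measure.restrict_map measurable_snd hF]
    exact hψm.aestronglyMeasurable hF
  rw [eulerianCost, kantorovichCost, hrun, hp, hm]

end Eulerian

theorem mainTheorem4 (d : ℕ)
    (k : ℝ≥0 → StateSpace d → StateSpace d → StateSpace d)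
    (L : ℝ≥0 → StateSpace d → StateSpace d → ℝ≥0)
    (U Ω : Set (StateSpace d))
    (hk : Continuous fun q : ℝ≥0 × StateSpace d × StateSpace d => k q.1 q.2.1 q.2.2)
    (hL : Continuous fun q : ℝ≥0 × StateSpace d × StateSpace d => L q.1 q.2.1 q.2.2)
    (hΩ : IsCompact Ω)
    (H0 : IsCompact U)
    (H1 : ∃ κ : ℝ, ∀ t x, ∀ u ∈ U, ‖k t x u‖ ≤ κ)
    (H2 : ∃ C : ℝ, ∀ t s x x', ∀ u ∈ U,
      ‖k t x u - k s x' u‖ ≤ C * (|(t : ℝ) - (s : ℝ)| + ‖x - x'‖))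
    (H3 : ∃ α : ℝ, 0 < α ∧ ∀ t x v, ∃ u ∈ U, inner ℝ (k t x u) v ≤ -α * ‖v‖)
    (H4 : ∃ β₁ β₂ : ℝ, 0 < β₂ ∧ ∀ t x, ∀ u ∈ U, β₂ ≤ (L t x u : ℝ) ∧ (L t x u : ℝ) ≤ β₁)
    (H5 : ∃ C : ℝ, ∀ t x x', ∀ u ∈ U, |(L t x u : ℝ) - (L t x' u : ℝ)| ≤ C * ‖x - x'‖)
    (H6 : ∀ t x, Convex ℝ
      {q : StateSpace d × ℝ | ∃ u ∈ U, k t x u = q.1 ∧ (L t x u : ℝ) ≤ q.2})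
    (μp μm : Measure (StateSpace d)) [IsFiniteMeasure μp] [IsFiniteMeasure μm]
    (hμp : μp Ωᶜ = 0) (hμm : μm Ωᶜ = 0)
    (ψp ψm : StateSpace d → ℝ)
    (hψp : ContinuousOn ψp (frontier Ω)) (hψm : ContinuousOn ψm (frontier Ω))
    (hNoArbitrage : ∀ x ∈ frontier Ω, ∀ y ∈ frontier Ω,
      ((ψm y - ψp x : ℝ) : EReal) ≤ ((transportCost k L U x y : ℝ≥0∞) : EReal)) :
    (∃ (γ : StateSpace d × StateSpace d → ℝ≥0 → StateSpace d)
        (u : StateSpace d × StateSpace d → ℝ≥0 → U)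
        (τ : StateSpace d × StateSpace d → ℝ≥0),
      IsBorelOptimalSelection k L U Ω γ u τ) ∧
    (∀ (γ : StateSpace d × StateSpace d → ℝ≥0 → StateSpace d)
        (u : StateSpace d × StateSpace d → ℝ≥0 → U)
        (τ : StateSpace d × StateSpace d → ℝ≥0),
      IsBorelOptimalSelection k L U Ω γ u τ →
      ∀ π : Measure (StateSpace d × StateSpace d),
        IsOptimalPlan k L U Ω ψp ψm μp μm π →
        (planDensity γ u τ π, planStopping τ π) ∈ admissibleEulerianPairs k U Ω μp μm ∧
        eulerianCost L Ω ψp ψm (planDensity γ u τ π) (planStopping τ π)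
          = kantorovichCost k L U Ω ψp ψm π) ∧
    eulerianValue k L U Ω ψp ψm μp μm ≤ kantorovichValue k L U Ω ψp ψm μp μm := by
  have hsel := exists_isBorelOptimalSelection (Ω := Ω) hk hL hΩ H0 H1 H3 H4 H6
  refine ⟨hsel, fun γ u τ h π hπ => ?_, ?_⟩
  · have := hπ.1.1
    exact ⟨planDensity_mem_admissibleEulerianPairs hk hΩ H1 hπ.1 h,
      eulerianCost_plan_eq hL hψp hψm hπ.1.2.1 h⟩
  · obtain ⟨γ, u, τ, h⟩ := hsel
    refine le_iInf₂ fun π hπ => ?_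
    have := hπ.1
    rw [← eulerianCost_plan_eq hL hψp hψm hπ.2.1 h]
    exact iInf₂_le (planDensity γ u τ π, planStopping τ π)
      (planDensity_mem_admissibleEulerianPairs hk hΩ H1 hπ h)
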